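/- **Definitions.** An *$\mathbf O$-category* is a category whose hom-sets are dcpos (posets in which every non-empty directed subset has a supremum) and whose composition is Scott-continuous. A functor between $\mathbf O$-categories is *locally continuous* if it acts Scott-continuously on hom-sets; $[\mathbf D\to\mathbf E]$ denotes the category of locally continuous functors $\mathbf D\to\mathbf E$ and all natural transformations; with the componentwise order it is again an $\mathbf O$-category, as is $\mathbf D\times\mathbf E$ with the product order. An embedding $e:X\to Y$ is a morphism with a (unique) $e^p:Y\to X$ such that $e^p e=\mathrm{id}_X$ and $e e^p\sqsubseteq \mathrm{id}_Y$. A cocone $\kappa:J\Rightarrow A$ of embeddings on an $\omega$-chain $J$ of embeddings is an *$\mathbf O$-colimit* if $(\kappa_n\kappa_n^p)_n$ is an ascending chain with supremum $\mathrm{id}_A$. An $\mathbf O$-category $\mathbf K$ *supports canonical fixed points* if it has an initial object $\bot$, it has zero morphisms and each $0_{XY}$ is the least element of $\mathbf K(X,Y)$, and every $\omega$-chain of embeddings has an $\mathbf O$-colimit. If $\mathbf C$ supports canonical fixed points, then so does $[\mathbf B\to\mathbf C]$ for every $\mathbf O$-category $\mathbf B$. **The dagger.** For each $\mathbf O$-category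 $\mathbf E$ that supports canonical fixed points, fix arbitrary choices of $\bot$ and of $\mathbf O$-colimits of $\omega$-chains of embeddings. For locally continuous $H:\mathbf E\to\mathbf E$ let $\mathsf{FIX}(H)$ be the chosen $\mathbf O$-colimit $\varphi^H$ of $\bot\to H\bot\to H^2\bot\to\cdots$, and for $\eta:H\Rightarrow H'$ let $\mathsf{FIX}(\eta)=\bigsqcup_n \varphi^{H'}_n\circ\eta^{(n)}_\bot\circ(\varphi^H_n)^p$, where $\eta^{(0)}=\mathrm{id}$ and $\eta^{(n+1)}=\eta\ast\eta^{(n)}$ (horizontal composition). For an $\mathbf O$-category $\mathbf D$ and a locally continuous $F:\mathbf D\times\mathbf E\to\mathbf E$ put $F^\dagger=\mathsf{FIX}\circ\Lambda F:\mathbf D\to\mathbf E$, where $\Lambda$ is currying, so $F^\dagger D=\mathsf{FIX}(F(D,-))$; similarly $\eta^\dagger=\mathsf{FIX}(\Lambda\eta)$ for $\eta:F\Rightarrow G$. This gives a functor $\dagger_{\mathbf D,\mathbf E}:[\mathbf D\times\mathbf E\to\mathbf E]\to[\mathbf D\to\mathbf E]$. **Theorem 1.** The dagger operation satisfies the Conway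 identities and the power identities up to natural isomorphism. That is, for all $\mathbf O$-categories $\mathbf P,\mathbf A,\mathbf B,\mathbf C$, where those at which a dagger is taken (namely $\mathbf C$ in 1, $\mathbf A$ and $\mathbf B$ in 2, $\mathbf B$ in 3, $\mathbf C$ in 4, $\mathbf B$ in 5) support canonical fixed points, and for all locally continuous functors $F,G$ of the indicated types: 1. (parameter) $(F\circ(G\times\mathrm{id}_{\mathbf C}))^\dagger\cong F^\dagger\circ G$ for $F:\mathbf B\times\mathbf C\to\mathbf C$ and $G:\mathbf A\to\mathbf B$; 2. (composition, parametrized dinaturality) $(G\circ\langle\pi_{\mathbf P},F\rangle)^\dagger\cong G\circ\langle\mathrm{id}_{\mathbf P},(F\circ\langle\pi_{\mathbf P},G\rangle)^\dagger\rangle$ for $F:\mathbf P\times\mathbf A\to\mathbf B$ and $G:\mathbf P\times\mathbf B\to\mathbf A$; 3. (double dagger) $(F^\dagger)^\dagger\cong(F\circ(\mathrm{id}_{\mathbf A}\times\langle\mathrm{id}_{\mathbf B},\mathrm{id}_{\mathbf B}\rangle))^\dagger$ for $F:\mathbf A\times\mathbf B\times\mathbf B\to\mathbf B$, the inner dagger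 being $\dagger_{\mathbf A\times\mathbf B,\mathbf B}$; 4. (abstraction) the two functors $[\mathbf A\times\mathbf B\times\mathbf C\to\mathbf C]\to[\mathbf A\to[\mathbf B\to\mathbf C]]$ given by $\Lambda\circ\dagger_{\mathbf A\times\mathbf B,\mathbf C}$ and by $\dagger_{\mathbf A,[\mathbf B\to\mathbf C]}\circ\Lambda\circ[\mathrm{id}_{\mathbf A}\times\langle\pi_{\mathbf B},\mathrm{ev}_{\mathbf B,\mathbf C}\rangle\to\mathrm{id}_{\mathbf C}]$ are naturally isomorphic; in particular $\Lambda(F^\dagger)\cong\bigl(\Lambda(F\circ(\mathrm{id}_{\mathbf A}\times\langle\pi_{\mathbf B},\mathrm{ev}_{\mathbf B,\mathbf C}\rangle))\bigr)^\dagger$ for each $F:\mathbf A\times\mathbf B\times\mathbf C\to\mathbf C$; 5. (power) $(F^n)^\dagger\cong F^\dagger$ for $F:\mathbf A\times\mathbf B\to\mathbf B$ and $n>1$, where $F^0=\pi_{\mathbf B}$ and $F^{n+1}=F\circ\langle\pi_{\mathbf A},F^n\rangle$. In particular this holds for all objects of $\mathbf{CFP}$, the 2-category of small $\mathbf O$-categories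 that support canonical fixed points, locally continuous functors and natural transformations. -/

import Mathlib

open CategoryTheory CategoryTheory.Limits

universe v₁ v₂ v₃ v₄ u₁ u₂ u₃ u₄

namespace OCat

/-! ### O-categories and locally continuous functors -/

/-- An O-category: a category whose hom-sets are dcpos (every nonempty directed subset has a
least upper bound) and whose composition is (Scott) continuous. -/
class OCategory (K : Type u₁) [Category.{v₁} K] where
  homOrder : ∀ X Y : K, PartialOrder (X ⟶ Y)
  exists_isLUB : ∀ {X Y : K} (d : Set (X ⟶ Y)), d.Nonempty → DirectedOn (· ≤ ·) d →
    ∃ f, IsLUB d f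
  continuous_comp : ∀ X Y Z : K,
    ScottContinuous (fun p : (X ⟶ Y) × (Y ⟶ Z) => p.1 ≫ p.2)

attribute [reducible, instance] OCategory.homOrder

section Basic

variable {K : Type u₁} [Category.{v₁} K] [OCategory K]

theorem comp_continuous {T : Type*} [Preorder T] {X Y Z : K} {f : T → (X ⟶ Y)}
    {g : T → (Y ⟶ Z)} (hf : ScottContinuous f) (hg : ScottContinuous g) :
    ScottContinuous (fun t => f t ≫ g t) :=
  (hf.prodMk hg).comp (OCategory.continuous_comp X Y Z)

theorem comp_le_comp {X Y Z : K} {f f' : X ⟶ Y} {g g' : Y ⟶ Z} (hf : f ≤ f') (hg : g ≤ g') :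
    f ≫ g ≤ f' ≫ g' :=
  (OCategory.continuous_comp X Y Z).monotone (show (f, g) ≤ (f', g') from ⟨hf, hg⟩)

theorem isLUB_range_comp {X Y Z : K} {a : ℕ → (X ⟶ Y)} (ha : Monotone a) {s : X ⟶ Y}
    (hs : IsLUB (Set.range a) s) (g : Y ⟶ Z) : IsLUB (Set.range fun n => a n ≫ g) (s ≫ g) := by
  have h := comp_continuous (K := K) (T := X ⟶ Y) ScottContinuous.id (ScottContinuous.const g)
    (Set.range_nonempty a) ha.directed_le.directedOn_range hs
  rw [← Set.range_comp] at h
  exact h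

theorem isLUB_range_precomp {X Y Z : K} {a : ℕ → (Y ⟶ Z)} (ha : Monotone a) {s : Y ⟶ Z}
    (hs : IsLUB (Set.range a) s) (g : X ⟶ Y) : IsLUB (Set.range fun n => g ≫ a n) (g ≫ s) := by
  have h := comp_continuous (K := K) (T := Y ⟶ Z) (ScottContinuous.const g) ScottContinuous.id
    (Set.range_nonempty a) ha.directed_le.directedOn_range hs
  rw [← Set.range_comp] at h
  exact h

end Basic

/-- A functor between O-categories is locally continuous if it acts continuously on hom-sets. -/
def LocallyContinuous {D : Type u₁} [Category.{v₁} D] [OCategory D] {E : Type u₂}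
    [Category.{v₂} E] [OCategory E] (F : D ⥤ E) : Prop :=
  ∀ X Y : D, ScottContinuous (fun f : X ⟶ Y => F.map f)

/-- Locally continuous functors `D ⥤ E`, the horizontal morphisms between O-categories. -/
structure LCFunctor (D : Type u₁) [Category.{v₁} D] [OCategory D] (E : Type u₂)
    [Category.{v₂} E] [OCategory E] extends D ⥤ E where
  lc : LocallyContinuous toFunctor

infixr:26 " ⥤ₒ " => LCFunctor

section FunctorCategory

variable {D : Type u₁} [Category.{v₁} D] [OCategory D] {E : Type u₂} [Category.{v₂} E]
  [OCategory E]

/-- The category of locally continuous functors, with all natural transformations. -/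
instance : Category (D ⥤ₒ E) where
  Hom F G := NatTrans F.toFunctor G.toFunctor
  id F := NatTrans.id F.toFunctor
  comp α β := NatTrans.vcomp α β

@[ext]
theorem LCFunctor.hom_ext {F G : D ⥤ₒ E} {α β : F ⟶ G} (h : ∀ X, α.app X = β.app X) : α = β :=
  NatTrans.ext (funext h)

@[simp] theorem LCFunctor.id_app (F : D ⥤ₒ E) (X : D) : NatTrans.app (𝟙 F) X = 𝟙 _ := rfl

@[simp] theorem LCFunctor.comp_app {F G H : D ⥤ₒ E} (α : F ⟶ G) (β : G ⟶ H) (X : D) :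
    NatTrans.app (α ≫ β) X = α.app X ≫ β.app X := rfl

/-- Natural transformations are ordered componentwise. -/
instance (F G : D ⥤ₒ E) : PartialOrder (F ⟶ G) :=
  PartialOrder.lift (fun α : F ⟶ G => fun X => NatTrans.app α X)
    (fun _ _ h => LCFunctor.hom_ext (congrFun h))

theorem LCFunctor.exists_lub {F G : D ⥤ₒ E} (d : Set (F ⟶ G)) (hne : d.Nonempty)
    (hd : DirectedOn (· ≤ ·) d) :
    ∃ α : F ⟶ G, ∀ X, IsLUB ((fun β : F ⟶ G => β.app X) '' d) (α.app X) := by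
  have hdX : ∀ X, DirectedOn (· ≤ ·) ((fun β : F ⟶ G => β.app X) '' d) := by
    rintro X _ ⟨a, ha, rfl⟩ _ ⟨b, hb, rfl⟩
    obtain ⟨c, hc, hac, hbc⟩ := hd a ha b hb
    exact ⟨_, ⟨c, hc, rfl⟩, hac X, hbc X⟩
  choose s hs using fun X => OCategory.exists_isLUB _ (hne.image fun β : F ⟶ G => β.app X) (hdX X)
  refine ⟨⟨s, fun X Y f => ?_⟩, hs⟩
  have h1 := comp_continuous (T := F.obj Y ⟶ G.obj Y) (ScottContinuous.const (F.map f))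
    ScottContinuous.id (hne.image _) (hdX Y) (hs Y)
  have h2 := comp_continuous (T := F.obj X ⟶ G.obj X) ScottContinuous.id
    (ScottContinuous.const (G.map f)) (hne.image _) (hdX X) (hs X)
  rw [Set.image_image] at h1 h2
  refine h1.unique ?_
  have h3 : (fun β : F ⟶ G => F.map f ≫ β.app Y) = fun β : F ⟶ G => β.app X ≫ G.map f :=
    funext fun β => β.naturality f
  exact h3 ▸ h2

theorem LCFunctor.isLUB_app {F G : D ⥤ₒ E} {d : Set (F ⟶ G)} (hne : d.Nonempty)
    (hd : DirectedOn (· ≤ ·) d) {α : F ⟶ G} (h : IsLUB d α) (X : D) :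
    IsLUB ((fun β : F ⟶ G => β.app X) '' d) (α.app X) := by
  obtain ⟨β, hβ⟩ := LCFunctor.exists_lub d hne hd
  have : IsLUB d β := ⟨fun γ hγ X => (hβ X).1 ⟨γ, hγ, rfl⟩, fun γ hγ X => (hβ X).2 (by
    rintro _ ⟨δ, hδ, rfl⟩
    exact hγ hδ X)⟩
  rw [h.unique this]
  exact hβ X

theorem LCFunctor.continuous_app (F G : D ⥤ₒ E) (X : D) :
    ScottContinuous (fun α : F ⟶ G => α.app X) :=
  fun _ hne hd _ h => LCFunctor.isLUB_app hne hd h X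

theorem LCFunctor.continuous_of_app {T : Type*} [Preorder T] {F G : D ⥤ₒ E} {a : T → (F ⟶ G)}
    (h : ∀ X, ScottContinuous fun t => (a t).app X) : ScottContinuous a := by
  intro d hne hd t ht
  refine ⟨?_, fun β hβ X => (h X hne hd ht).2 ?_⟩
  · rintro _ ⟨x, hx, rfl⟩ X
    exact (h X hne hd ht).1 ⟨x, hx, rfl⟩
  · rintro _ ⟨x, hx, rfl⟩
    exact hβ ⟨x, hx, rfl⟩ X

instance : OCategory (D ⥤ₒ E) where
  homOrder _ _ := inferInstance
  exists_isLUB d hne hd := by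
    obtain ⟨α, hα⟩ := LCFunctor.exists_lub d hne hd
    refine ⟨α, fun γ hγ X => (hα X).1 ⟨γ, hγ, rfl⟩, fun γ hγ X => (hα X).2 ?_⟩
    rintro _ ⟨δ, hδ, rfl⟩
    exact hγ hδ X
  continuous_comp F G H := LCFunctor.continuous_of_app fun X =>
    comp_continuous (ScottContinuous.fst.comp (LCFunctor.continuous_app F G X))
      (ScottContinuous.snd.comp (LCFunctor.continuous_app G H X))

end FunctorCategory

/-- The product of O-categories, with the product order on hom-sets. -/
instance {D : Type u₁} [Category.{v₁} D] [OCategory D] {E : Type u₂} [Category.{v₂} E]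
    [OCategory E] : OCategory (D × E) where
  homOrder X Y := inferInstanceAs (PartialOrder ((X.1 ⟶ Y.1) × (X.2 ⟶ Y.2)))
  exists_isLUB {X Y} d hne hd := by
    obtain ⟨f, hf⟩ := OCategory.exists_isLUB (Prod.fst '' d) (hne.image _) hd.fst
    obtain ⟨g, hg⟩ := OCategory.exists_isLUB (Prod.snd '' d) (hne.image _) hd.snd
    exact ⟨(f, g), isLUB_prod.2 ⟨hf, hg⟩⟩
  continuous_comp X Y Z := by
    let T := ((X.1 ⟶ Y.1) × (X.2 ⟶ Y.2)) × ((Y.1 ⟶ Z.1) × (Y.2 ⟶ Z.2))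
    have h1 : ScottContinuous (fun p : T => p.1.1 ≫ p.2.1) :=
      comp_continuous (ScottContinuous.fst.comp ScottContinuous.fst)
        (ScottContinuous.snd.comp ScottContinuous.fst)
    have h2 : ScottContinuous (fun p : T => p.1.2 ≫ p.2.2) :=
      comp_continuous (ScottContinuous.fst.comp ScottContinuous.snd)
        (ScottContinuous.snd.comp ScottContinuous.snd)
    exact h1.prodMk h2

/-! ### The cartesian closed structure on locally continuous functors -/

namespace LCFunctor

section Combinators

variable {A : Type u₁} [Category.{v₁} A] [OCategory A] {B : Type u₂} [Category.{v₂} B]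
  [OCategory B] {C : Type u₃} [Category.{v₃} C] [OCategory C] {D : Type u₄} [Category.{v₄} D]
  [OCategory D]

variable (A) in
/-- The identity functor. -/
def id : A ⥤ₒ A where
  toFunctor := 𝟭 A
  lc _ _ := ScottContinuous.id

/-- Composition `G ∘ F`, written in diagrammatic order. -/
def comp (F : A ⥤ₒ B) (G : B ⥤ₒ C) : A ⥤ₒ C where
  toFunctor := F.toFunctor ⋙ G.toFunctor
  lc X Y := (F.lc X Y).comp (G.lc _ _)

variable (A B) in
/-- The first projection. -/
def fst : A × B ⥤ₒ A where
  toFunctor := CategoryTheory.Prod.fst A B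
  lc _ _ := ScottContinuous.fst

variable (A B) in
/-- The second projection. -/
def snd : A × B ⥤ₒ B where
  toFunctor := CategoryTheory.Prod.snd A B
  lc _ _ := ScottContinuous.snd

/-- The pairing `⟨F, G⟩`. -/
def pair (F : A ⥤ₒ B) (G : A ⥤ₒ C) : A ⥤ₒ B × C where
  toFunctor := F.toFunctor.prod' G.toFunctor
  lc X Y := (F.lc X Y).prodMk (G.lc X Y)

/-- The product `F × G` of two functors. -/
def prodMap (F : A ⥤ₒ B) (G : C ⥤ₒ D) : A × C ⥤ₒ B × D :=
  pair ((fst A C).comp F) ((snd A C).comp G)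

variable (A B C) in
/-- The canonical isomorphism `(A × B) × C ⥤ A × (B × C)`. -/
def assoc : (A × B) × C ⥤ₒ A × (B × C) :=
  pair ((fst (A × B) C).comp (fst A B)) (pair ((fst (A × B) C).comp (snd A B)) (snd (A × B) C))

variable (A B) in
/-- Evaluation `(F, X) ↦ F X`. -/
def ev : (A ⥤ₒ B) × A ⥤ₒ B where
  obj p := p.1.obj p.2
  map {p q} f := p.1.map f.2 ≫ f.1.app q.2
  map_id p := by
    change p.1.map (𝟙 p.2) ≫ 𝟙 _ = _
    simp
  map_comp {p q r} f g := by
    change p.1.map (f.2 ≫ g.2) ≫ (f.1.app r.2 ≫ g.1.app r.2) = _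
    have := f.1.naturality g.2
    simp only [Functor.map_comp, Category.assoc]
    rw [← Category.assoc (p.1.map g.2), this, Category.assoc]
  lc p q := comp_continuous (ScottContinuous.snd.comp (p.1.lc _ _))
    (ScottContinuous.fst.comp (continuous_app p.1 q.1 q.2))

/-- The partial application `F(X, -)`. -/
def partialApp (F : A × B ⥤ₒ C) (X : A) : B ⥤ₒ C where
  obj Y := F.obj (X, Y)
  map g := F.map (Prod.mkHom (𝟙 X) g)
  map_id Y := F.map_id (X, Y)
  map_comp f g := by
    rw [← F.map_comp]
    congr 1
    simp
  lc _ _ := ((ScottContinuous.const (𝟙 X)).prodMk ScottContinuous.id).comp (F.lc _ _)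

/-- The abstraction `Λ F : X ↦ F(X, -)`. -/
def curry (F : A × B ⥤ₒ C) : A ⥤ₒ (B ⥤ₒ C) where
  obj X := F.partialApp X
  map {X X'} f :=
    { app := fun Y => F.map (Prod.mkHom f (𝟙 Y))
      naturality := fun Y Y' g => by
        dsimp only [partialApp]
        rw [← F.map_comp, ← F.map_comp]
        congr 1
        simp }
  map_id X := hom_ext fun Y => F.map_id (X, Y)
  map_comp {X X' X''} f g := hom_ext fun Y => by
    have h : Prod.mkHom (f ≫ g) (𝟙 Y) = Prod.mkHom f (𝟙 Y) ≫ Prod.mkHom g (𝟙 Y) := by simp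
    exact (congrArg (fun k => F.map k) h).trans (F.map_comp _ _)
  lc _ _ := continuous_of_app fun Y =>
    (ScottContinuous.id.prodMk (ScottContinuous.const (𝟙 Y))).comp (F.lc _ _)

variable (A B C) in
/-- The abstraction functor `Λ`, with its action on natural transformations. -/
def curryFunctor : (A × B ⥤ₒ C) ⥤ (A ⥤ₒ (B ⥤ₒ C)) where
  obj F := F.curry
  map α :=
    { app := fun X =>
        { app := fun Y => α.app (X, Y)
          naturality := fun _ _ g => α.naturality (Prod.mkHom (𝟙 X) g) }
      naturality := fun _ _ f => hom_ext fun Y => α.naturality (Prod.mkHom f (𝟙 Y)) }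
  map_id _ := rfl
  map_comp _ _ := rfl

variable (C) in
/-- Precomposition `[G → id] : H ↦ H ∘ G`, with its action on natural transformations. -/
def precomp (G : A ⥤ₒ B) : (B ⥤ₒ C) ⥤ (A ⥤ₒ C) where
  obj H := G.comp H
  map α :=
    { app := fun X => α.app (G.obj X)
      naturality := fun _ _ f => α.naturality (G.map f) }
  map_id _ := rfl
  map_comp _ _ := rfl

variable (A) in
/-- Postcomposition `[id → H] : G ↦ H ∘ G`, with its action on natural transformations. -/
def postcomp (H : B ⥤ₒ C) : (A ⥤ₒ B) ⥤ (A ⥤ₒ C) where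
  obj G := G.comp H
  map {G G'} α :=
    { app := fun X => H.map (α.app X)
      naturality := fun X Y f => by
        have h := congrArg (fun k => H.map k) (α.naturality f)
        exact (H.map_comp _ _).symm.trans (h.trans (H.map_comp _ _)) }
  map_id G := hom_ext fun X => H.map_id _
  map_comp α β := hom_ext fun X => H.map_comp _ _

/-- The powers `F⁰ = π₂` and `Fⁿ⁺¹ = F ∘ ⟨π₁, Fⁿ⟩` of `F : A × B ⥤ B`. -/
def power (F : A × B ⥤ₒ B) : ℕ → (A × B ⥤ₒ B)
  | 0 => snd A B
  | n + 1 => (pair (fst A B) (F.power n)).comp F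

end Combinators

end LCFunctor

/-! ### Embeddings, O-colimits, canonical fixed points -/

section Embeddings

variable {K : Type u₁} [Category.{v₁} K] [OCategory K]

/-- `(e, p)` is an embedding-projection pair. -/
def IsEPPair {X Y : K} (e : X ⟶ Y) (p : Y ⟶ X) : Prop :=
  e ≫ p = 𝟙 X ∧ p ≫ e ≤ 𝟙 Y

/-- `e` is an embedding. -/
def IsEmbedding {X Y : K} (e : X ⟶ Y) : Prop :=
  ∃ p, IsEPPair e p

theorem IsEPPair.comp {X Y Z : K} {e : X ⟶ Y} {p : Y ⟶ X} {e' : Y ⟶ Z} {p' : Z ⟶ Y}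
    (h : IsEPPair e p) (h' : IsEPPair e' p') : IsEPPair (e ≫ e') (p' ≫ p) := by
  refine ⟨?_, ?_⟩
  · rw [Category.assoc, ← Category.assoc e', h'.1, Category.id_comp, h.1]
  · calc (p' ≫ p) ≫ e ≫ e' = p' ≫ (p ≫ e) ≫ e' := by simp only [Category.assoc]
      _ ≤ p' ≫ 𝟙 _ ≫ e' := comp_le_comp le_rfl (comp_le_comp h.2 le_rfl)
      _ ≤ 𝟙 _ := by rw [Category.id_comp]; exact h'.2

theorem IsEmbedding.id (X : K) : IsEmbedding (𝟙 X) :=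
  ⟨𝟙 X, Category.id_comp _, (Category.id_comp _).le⟩

theorem IsEmbedding.comp {X Y Z : K} {e : X ⟶ Y} {e' : Y ⟶ Z} (h : IsEmbedding e)
    (h' : IsEmbedding e') : IsEmbedding (e ≫ e') := by
  obtain ⟨p, hp⟩ := h
  obtain ⟨p', hp'⟩ := h'
  exact ⟨_, hp.comp hp'⟩

theorem IsEPPair.proj_unique {X Y : K} {e : X ⟶ Y} {p q : Y ⟶ X} (hp : IsEPPair e p)
    (hq : IsEPPair e q) : p = q := by
  have key : ∀ {p q : Y ⟶ X}, IsEPPair e p → IsEPPair e q → p ≤ q := by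
    intro p q hp hq
    calc p = p ≫ e ≫ q := by rw [hq.1, Category.comp_id]
      _ = (p ≫ e) ≫ q := by rw [Category.assoc]
      _ ≤ 𝟙 _ ≫ q := comp_le_comp hp.2 le_rfl
      _ = q := Category.id_comp _
  exact le_antisymm (key hp hq) (key hq hp)

theorem LCFunctor.map_isEPPair {L : Type u₂} [Category.{v₂} L] [OCategory L] (F : K ⥤ₒ L)
    {X Y : K} {e : X ⟶ Y} {p : Y ⟶ X} (h : IsEPPair e p) : IsEPPair (F.map e) (F.map p) := by
  refine ⟨by rw [← F.map_comp, h.1, F.map_id], ?_⟩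
  rw [← F.map_comp, ← F.map_id]
  exact (F.lc _ _).monotone h.2

theorem LCFunctor.map_isEmbedding {L : Type u₂} [Category.{v₂} L] [OCategory L] (F : K ⥤ₒ L)
    {X Y : K} {e : X ⟶ Y} (h : IsEmbedding e) : IsEmbedding (F.map e) :=
  let ⟨p, hp⟩ := h
  ⟨F.map p, F.map_isEPPair hp⟩

/-- An `ω`-chain all of whose morphisms are embeddings, i.e. an `ω`-chain in `Kᵉ`. -/
def IsEmbeddingChain (J : ℕ ⥤ K) : Prop :=
  ∀ ⦃m n : ℕ⦄ (f : m ⟶ n), IsEmbedding (J.map f)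

/-- The cocone `κ` consists of embeddings and is an O-colimit: the idempotents `κₙ ∘ κₙᵖ` form an
ascending chain with supremum the identity (the projections `κₙᵖ` are unique). -/
def IsOColimit {J : ℕ ⥤ K} (c : Cocone J) : Prop :=
  ∃ p : ∀ n : ℕ, c.pt ⟶ J.obj n, (∀ n, IsEPPair (c.ι.app n) (p n)) ∧
    Monotone (fun n => p n ≫ c.ι.app n) ∧ IsLUB (Set.range fun n => p n ≫ c.ι.app n) (𝟙 c.pt)

variable (K) in
/-- Every `ω`-chain of embeddings has an O-colimit. -/
def OCocomplete : Prop :=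
  ∀ J : ℕ ⥤ K, IsEmbeddingChain J → ∃ c : Cocone J, IsOColimit c

variable (K) in
/-- `K` has zero morphisms, and they are the least elements of the hom-sets. -/
def HasStrictMorphisms : Prop :=
  ∃ _ : HasZeroMorphisms K, ∀ (X Y : K) (f : X ⟶ Y), (0 : X ⟶ Y) ≤ f

variable (K) in
/-- `K` supports canonical fixed points. -/
class SupportsCanonicalFixedPoints : Prop where
  hasInitial : HasInitial K
  strict : HasStrictMorphisms K
  cocomplete : OCocomplete K

variable (K) in
/-- A choice of an initial object and of an O-colimit for each `ω`-chain of embeddings. -/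
structure FixChoice where
  bot : K
  isInitial : IsInitial bot
  colim : ∀ J : ℕ ⥤ K, IsEmbeddingChain J → Cocone J
  isOColimit : ∀ (J : ℕ ⥤ K) (hJ : IsEmbeddingChain J), IsOColimit (colim J hJ)

/-- Such a choice exists. -/
theorem FixChoice.nonempty [h : SupportsCanonicalFixedPoints K] : Nonempty (FixChoice K) := by
  have := h.hasInitial
  choose c hc using h.cocomplete
  exact ⟨⟨⊥_ K, initialIsInitial, c, hc⟩⟩

namespace IsOColimit

variable {J : ℕ ⥤ K} {c : Cocone J} (hc : IsOColimit c)

/-- The projection `κₙᵖ`. -/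
noncomputable def proj (n : ℕ) : c.pt ⟶ J.obj n := hc.choose n

theorem proj_isEPPair (n : ℕ) : IsEPPair (c.ι.app n) (hc.proj n) := hc.choose_spec.1 n

theorem monotone_proj : Monotone (fun n => hc.proj n ≫ c.ι.app n) := hc.choose_spec.2.1

theorem isLUB_proj : IsLUB (Set.range fun n => hc.proj n ≫ c.ι.app n) (𝟙 c.pt) :=
  hc.choose_spec.2.2

theorem proj_comp_le {m n : ℕ} (f : m ⟶ n) : hc.proj m ≫ J.map f ≤ hc.proj n := by
  calc hc.proj m ≫ J.map f = (hc.proj m ≫ J.map f) ≫ c.ι.app n ≫ hc.proj n := by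
        rw [(hc.proj_isEPPair n).1, Category.comp_id]
    _ = (hc.proj m ≫ c.ι.app m) ≫ hc.proj n := by
        rw [← c.w f]; simp only [Category.assoc]
    _ ≤ 𝟙 _ ≫ hc.proj n := comp_le_comp (hc.proj_isEPPair m).2 le_rfl
    _ = hc.proj n := Category.id_comp _

variable {A : K}

theorem monotone_med (s : J ⟶ (Functor.const ℕ).obj A) :
    Monotone (fun n => hc.proj n ≫ (s.app n : J.obj n ⟶ A)) := by
  intro m n hmn
  have h : (s.app m : J.obj m ⟶ A) = J.map (homOfLE hmn) ≫ s.app n := by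
    simp
  dsimp only
  rw [h, ← Category.assoc]
  exact comp_le_comp (hc.proj_comp_le _) le_rfl

theorem exists_med (s : J ⟶ (Functor.const ℕ).obj A) :
    ∃ θ : c.pt ⟶ A, IsLUB (Set.range fun n => hc.proj n ≫ (s.app n : J.obj n ⟶ A)) θ :=
  OCategory.exists_isLUB _ (Set.range_nonempty _)
    (hc.monotone_med s).directed_le.directedOn_range

/-- The mediating morphism `⨆ₙ sₙ ∘ κₙᵖ` from an O-colimit `κ` to a cocone `s`. -/
noncomputable def med (s : J ⟶ (Functor.const ℕ).obj A) : c.pt ⟶ A := (hc.exists_med s).choose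

theorem isLUB_med (s : J ⟶ (Functor.const ℕ).obj A) :
    IsLUB (Set.range fun n => hc.proj n ≫ (s.app n : J.obj n ⟶ A)) (hc.med s) :=
  (hc.exists_med s).choose_spec

theorem fac (s : J ⟶ (Functor.const ℕ).obj A) (n : ℕ) : c.ι.app n ≫ hc.med s = s.app n := by
  refine (isLUB_range_precomp (hc.monotone_med s) (hc.isLUB_med s) (c.ι.app n)).unique
    (IsGreatest.isLUB ⟨⟨n, ?_⟩, ?_⟩)
  · dsimp only
    rw [← Category.assoc, (hc.proj_isEPPair n).1]
    exact Category.id_comp _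
  · rintro _ ⟨m, rfl⟩
    have hs : ∀ {i : ℕ} (h : i ≤ max n m), (s.app i : J.obj i ⟶ A) =
        J.map (homOfLE h) ≫ s.app (max n m) := fun h => by
      simp
    have hn := hs (le_max_left n m)
    have hm := hs (le_max_right n m)
    have hw := c.w (homOfLE (le_max_left n m))
    calc c.ι.app n ≫ hc.proj m ≫ (s.app m : J.obj m ⟶ A)
        = J.map (homOfLE (le_max_left n m)) ≫ c.ι.app (max n m) ≫
          (hc.proj m ≫ J.map (homOfLE (le_max_right n m))) ≫ s.app (max n m) := by
          rw [hm, ← hw]; simp only [Category.assoc]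
      _ ≤ J.map (homOfLE (le_max_left n m)) ≫ c.ι.app (max n m) ≫
          hc.proj (max n m) ≫ s.app (max n m) :=
          comp_le_comp le_rfl (comp_le_comp le_rfl
            (comp_le_comp (hc.proj_comp_le _) le_rfl))
      _ = s.app n := by
          rw [hn, ← Category.assoc (c.ι.app _), (hc.proj_isEPPair _).1]
          congr 1
          exact Category.id_comp _

theorem hom_ext (hc : IsOColimit c) {f g : c.pt ⟶ A} (h : ∀ n, c.ι.app n ≫ f = c.ι.app n ≫ g) : f = g := by
  have hf := isLUB_range_comp hc.monotone_proj hc.isLUB_proj f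
  have hg := isLUB_range_comp hc.monotone_proj hc.isLUB_proj g
  simp only [Category.assoc, h, Category.id_comp] at hf hg
  exact hf.unique hg

theorem continuous_med {T : Type*} [Preorder T] {a : T → (J ⟶ (Functor.const ℕ).obj A)}
    (h : ∀ n, ScottContinuous fun t => ((a t).app n : J.obj n ⟶ A)) :
    ScottContinuous fun t => hc.med (a t) := by
  intro d hne hd t ht
  refine ⟨?_, fun b hb => (hc.isLUB_med (a t)).2 ?_⟩
  · rintro _ ⟨x, hx, rfl⟩
    refine (hc.isLUB_med (a x)).2 ?_
    rintro _ ⟨n, rfl⟩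
    exact (comp_le_comp le_rfl ((h n).monotone (ht.1 hx))).trans
      ((hc.isLUB_med (a t)).1 ⟨n, rfl⟩)
  · rintro _ ⟨n, rfl⟩
    refine (comp_continuous (ScottContinuous.const (hc.proj n)) (h n) hne hd ht).2 ?_
    rintro _ ⟨x, hx, rfl⟩
    exact ((hc.isLUB_med (a x)).1 ⟨n, rfl⟩).trans (hb ⟨x, hx, rfl⟩)

/-- The action `⨆ₙ κ'ₙ ∘ αₙ ∘ κₙᵖ` of taking O-colimits on a morphism `α` of chains. -/
noncomputable def map {J' : ℕ ⥤ K} (c' : Cocone J') (α : J ⟶ J') : c.pt ⟶ c'.pt :=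
  hc.med (α ≫ c'.ι)

theorem ι_map {J' : ℕ ⥤ K} (c' : Cocone J') (α : J ⟶ J') (n : ℕ) :
    c.ι.app n ≫ hc.map c' α = α.app n ≫ c'.ι.app n :=
  hc.fac _ n

theorem map_id : hc.map c (𝟙 J) = 𝟙 c.pt :=
  hc.hom_ext fun n => by simp [ι_map]

theorem map_comp {J' J'' : ℕ ⥤ K} {c' : Cocone J'} (hc' : IsOColimit c') (c'' : Cocone J'')
    (α : J ⟶ J') (β : J' ⟶ J'') : hc.map c'' (α ≫ β) = hc.map c' α ≫ hc'.map c'' β :=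
  hc.hom_ext fun n => by
    rw [ι_map, ← Category.assoc, ι_map, Category.assoc, ι_map, NatTrans.comp_app, Category.assoc]

theorem continuous_map {T : Type*} [Preorder T] {J' : ℕ ⥤ K} (c' : Cocone J') {a : T → (J ⟶ J')}
    (h : ∀ n, ScottContinuous fun t => (a t).app n) : ScottContinuous fun t => hc.map c' (a t) :=
  hc.continuous_med fun n => comp_continuous (h n) (ScottContinuous.const (c'.ι.app n))

end IsOColimit

/-! ### The dagger operation -/

theorem isEmbeddingChain_ofSequence {X : ℕ → K} (f : ∀ n, X n ⟶ X (n + 1))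
    (hf : ∀ n, IsEmbedding (f n)) : IsEmbeddingChain (Functor.ofSequence f) := by
  intro m n g
  obtain ⟨k, rfl⟩ := Nat.exists_eq_add_of_le (leOfHom g)
  obtain rfl := Subsingleton.elim g (homOfLE (by lia))
  induction k with
  | zero =>
    have : (homOfLE (Nat.le_add_right m 0) : m ⟶ m + 0) = 𝟙 m := rfl
    rw [this, CategoryTheory.Functor.map_id]
    exact IsEmbedding.id _
  | succ k ih =>
    have : (homOfLE (Nat.le_add_right m (k + 1)) : m ⟶ m + (k + 1)) =
      homOfLE (Nat.le_add_right m k) ≫ homOfLE (Nat.le_add_right (m + k) 1) := rfl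
    rw [this, Functor.map_comp, Functor.ofSequence_map_homOfLE_succ]
    exact ih.comp (hf _)

theorem isEmbedding_of_isInitial (hK : HasStrictMorphisms K) {X : K} (hX : IsInitial X) {Y : K}
    (f : X ⟶ Y) : IsEmbedding f := by
  obtain ⟨_, h0⟩ := hK
  refine ⟨0, hX.hom_ext _ _, ?_⟩
  rw [zero_comp]
  exact h0 _ _ _

namespace FixChoice

variable (c : FixChoice K)

/-- The iterates `Fⁿ ⊥`. -/
def iter (F : K ⥤ₒ K) : ℕ → K
  | 0 => c.bot
  | n + 1 => F.obj (iter F n)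

/-- The links `Fⁿ(⊥ → F ⊥)`. -/
def link (F : K ⥤ₒ K) : ∀ n, c.iter F n ⟶ c.iter F (n + 1)
  | 0 => c.isInitial.to _
  | n + 1 => F.map (link F n)

/-- The `ω`-chain `⊥ → F ⊥ → F² ⊥ → ⋯`. -/
def chain (F : K ⥤ₒ K) : ℕ ⥤ K := Functor.ofSequence (c.link F)

/-- The components `η⁽ⁿ⁾ : Fⁿ ⊥ → Gⁿ ⊥` of the horizontal iterates of `η`. -/
def iterMap {F G : K ⥤ₒ K} (η : F ⟶ G) : ∀ n, c.iter F n ⟶ c.iter G n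
  | 0 => 𝟙 _
  | n + 1 => F.map (iterMap η n) ≫ η.app (c.iter G n)

theorem link_iterMap {F G : K ⥤ₒ K} (η : F ⟶ G) (n : ℕ) :
    c.link F n ≫ c.iterMap η (n + 1) = c.iterMap η n ≫ c.link G n := by
  induction n with
  | zero => exact c.isInitial.hom_ext _ _
  | succ n ih =>
    have h := congrArg (fun k => F.map k) ih
    simp only [Functor.map_comp] at h
    calc F.map (c.link F n) ≫ F.map (c.iterMap η (n + 1)) ≫ η.app (c.iter G (n + 1))
        = F.map (c.iterMap η n) ≫ F.map (c.link G n) ≫ η.app (c.iter G (n + 1)) := by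
          rw [← Category.assoc, h, Category.assoc]
      _ = F.map (c.iterMap η n) ≫ η.app (c.iter G n) ≫ G.map (c.link G n) := by
          congr 1
          exact η.naturality _
      _ = (F.map (c.iterMap η n) ≫ η.app (c.iter G n)) ≫ G.map (c.link G n) :=
          (Category.assoc _ _ _).symm

/-- The morphism of chains induced by a natural transformation. -/
def chainMap {F G : K ⥤ₒ K} (η : F ⟶ G) : c.chain F ⟶ c.chain G :=
  NatTrans.ofSequence (c.iterMap η) fun n => by
    simp only [chain, Functor.ofSequence_map_homOfLE_succ]
    exact c.link_iterMap η n

theorem chainMap_id (F : K ⥤ₒ K) : c.chainMap (𝟙 F) = 𝟙 _ := by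
  ext n
  change c.iterMap (𝟙 F) n = 𝟙 (c.iter F n)
  induction n with
  | zero => rfl
  | succ n ih =>
    change F.map _ ≫ 𝟙 _ = 𝟙 (F.obj _)
    rw [ih, F.map_id, Category.comp_id]

theorem chainMap_comp {F G H : K ⥤ₒ K} (η : F ⟶ G) (ρ : G ⟶ H) :
    c.chainMap (η ≫ ρ) = c.chainMap η ≫ c.chainMap ρ := by
  ext n
  change c.iterMap (η ≫ ρ) n = c.iterMap η n ≫ c.iterMap ρ n
  induction n with
  | zero => exact (Category.id_comp _).symm
  | succ n ih =>
    change F.map _ ≫ η.app _ ≫ ρ.app _ = (F.map _ ≫ η.app _) ≫ G.map _ ≫ ρ.app _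
    rw [ih, F.map_comp, Category.assoc, Category.assoc]
    congr 1
    rw [← Category.assoc, ← Category.assoc]
    congr 1
    exact η.naturality _

theorem continuous_iterMap (F G : K ⥤ₒ K) (n : ℕ) :
    ScottContinuous fun η : F ⟶ G => c.iterMap η n := by
  induction n with
  | zero => exact ScottContinuous.const _
  | succ n ih => exact comp_continuous (ih.comp (F.lc _ _)) (LCFunctor.continuous_app F G _)

variable [hK : SupportsCanonicalFixedPoints K]

theorem isEmbeddingChain_chain (F : K ⥤ₒ K) : IsEmbeddingChain (c.chain F) := by
  refine isEmbeddingChain_ofSequence _ fun n => ?_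
  induction n with
  | zero => exact isEmbedding_of_isInitial hK.strict c.isInitial _
  | succ n ih => exact F.map_isEmbedding ih

/-- The chosen O-colimit of `⊥ → F ⊥ → F² ⊥ → ⋯`. -/
def fixCocone (F : K ⥤ₒ K) : Cocone (c.chain F) := c.colim _ (c.isEmbeddingChain_chain F)

theorem isOColimit_fixCocone (F : K ⥤ₒ K) : IsOColimit (c.fixCocone F) := c.isOColimit _ _

/-- The canonical-fixed-point functor `FIX`: on objects the chosen O-colimit of
`⊥ → F ⊥ → F² ⊥ → ⋯`, on natural transformations `⨆ₙ γₙ ∘ η⁽ⁿ⁾ ∘ φₙᵖ`. -/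
noncomputable def FIX : (K ⥤ₒ K) ⥤ₒ K where
  obj F := (c.fixCocone F).pt
  map {F G} η := (c.isOColimit_fixCocone F).map (c.fixCocone G) (c.chainMap η)
  map_id F := by rw [chainMap_id, IsOColimit.map_id]
  map_comp {F G H} η ρ := by
    rw [chainMap_comp, (c.isOColimit_fixCocone F).map_comp (c.isOColimit_fixCocone G)]
  lc F G := (c.isOColimit_fixCocone F).continuous_map _ (c.continuous_iterMap F G)

/-- The dagger functor `F ↦ F†`, `F† X = FIX (F(X, -))`, with its action on natural
transformations. -/
noncomputable def daggerFunctor (D : Type u₂) [Category.{v₂} D] [OCategory D] :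
    (D × K ⥤ₒ K) ⥤ (D ⥤ₒ K) :=
  LCFunctor.curryFunctor D K K ⋙ LCFunctor.postcomp D c.FIX

/-- The dagger `F† : D ⥤ K` of a locally continuous functor `F : D × K ⥤ K`. -/
noncomputable def dagger {D : Type u₂} [Category.{v₂} D] [OCategory D] (F : D × K ⥤ₒ K) :
    D ⥤ₒ K :=
  (c.daggerFunctor D).obj F

end FixChoice

end Embeddings

/-! ### Functor categories support canonical fixed points -/

section FunctorCFP

variable {B : Type u₁} [Category.{v₁} B] [OCategory B] {C : Type u₂} [Category.{v₂} C]
  [OCategory C]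

/-- The constant functor. -/
def LCFunctor.const (X : C) : B ⥤ₒ C where
  toFunctor := (Functor.const B).obj X
  lc _ _ := ScottContinuous.const _

/-- Evaluation of functors at a fixed object. -/
def LCFunctor.evalAt (C : Type u₂) [Category.{v₂} C] [OCategory C] (X : B) : (B ⥤ₒ C) ⥤ C where
  obj F := F.obj X
  map α := α.app X

/-- The morphism between the evaluations of a chain of functors at two objects. -/
def LCFunctor.evalMap (J : ℕ ⥤ (B ⥤ₒ C)) {X Y : B} (f : X ⟶ Y) :
    J ⋙ LCFunctor.evalAt C X ⟶ J ⋙ LCFunctor.evalAt C Y where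
  app n := (J.obj n).map f
  naturality _ _ g := ((J.map g).naturality f).symm

theorem LCFunctor.isEPPair_app {F G : B ⥤ₒ C} {e : F ⟶ G} {p : G ⟶ F} (h : IsEPPair e p) (X : B) :
    IsEPPair (e.app X) (p.app X) :=
  ⟨congrArg (fun α : F ⟶ F => α.app X) h.1, h.2 X⟩

theorem hasInitial_lcFunctor (h : HasInitial C) : HasInitial (B ⥤ₒ C) := by
  refine (IsInitial.ofUniqueHom (X := (LCFunctor.const (⊥_ C) : B ⥤ₒ C))
    (fun F => NatTrans.mk (fun X => initial.to (F.obj X))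
      fun _ _ _ => initialIsInitial.hom_ext _ _)
    (fun F α => LCFunctor.hom_ext fun X => initialIsInitial.hom_ext _ _)).hasInitial

theorem strict_lcFunctor (h : HasStrictMorphisms C) : HasStrictMorphisms (B ⥤ₒ C) := by
  obtain ⟨_, h0⟩ := h
  refine ⟨{ zero := fun F G => ⟨⟨fun X => 0, fun _ _ _ => by simp⟩⟩
            comp_zero := fun α H => LCFunctor.hom_ext fun X => comp_zero
            zero_comp := fun F {G H} α => LCFunctor.hom_ext fun X => zero_comp },
    fun F G α X => h0 _ _ _⟩

theorem oCocomplete_lcFunctor (h : OCocomplete C) : OCocomplete (B ⥤ₒ C) := by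
  intro J hJ
  have hJX : ∀ X : B, IsEmbeddingChain (J ⋙ LCFunctor.evalAt C X) := fun X m n f => by
    obtain ⟨p, hp⟩ := hJ f
    exact ⟨_, LCFunctor.isEPPair_app hp X⟩
  choose c hc using fun X : B => h _ (hJX X)
  let L : B ⥤ₒ C :=
    { obj := fun X => (c X).pt
      map := fun {X Y} f => (hc X).map (c Y) (LCFunctor.evalMap J f)
      map_id := fun X => by
        rw [← (hc X).map_id]
        congr 1
        ext n
        exact (J.obj n).map_id X
      map_comp := fun {X Y Z} f g => by
        rw [← (hc X).map_comp (hc Y)]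
        congr 1
        ext n
        exact (J.obj n).map_comp f g
      lc := fun X Y => (hc X).continuous_map _ fun n => (J.obj n).lc X Y }
  let κ : Cocone J :=
    { pt := L
      ι :=
        { app := fun n => ⟨fun X => (c X).ι.app n, fun X Y f => ((hc X).ι_map (c Y) (LCFunctor.evalMap J f) n).symm⟩
          naturality := fun m n f => LCFunctor.hom_ext fun X => (c X).ι.naturality f } }
  have hproj : ∀ (X : B) {m n : ℕ} (f : n ⟶ m) (q : J.obj m ⟶ J.obj n), IsEPPair (J.map f) q →
      (c X).ι.app m ≫ (hc X).proj n = (LCFunctor.evalAt C X).map q := by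
    intro X m n f q hq
    have h1 : IsEPPair ((c X).ι.app n) ((hc X).proj m ≫ (LCFunctor.evalAt C X).map q) := by
      have := (LCFunctor.isEPPair_app hq X).comp ((hc X).proj_isEPPair m)
      have hw : (J.map f).app X ≫ (c X).ι.app m = (c X).ι.app n := (c X).w f
      rwa [hw] at this
    rw [((hc X).proj_isEPPair n).proj_unique h1, ← Category.assoc, ((hc X).proj_isEPPair m).1]
    exact Category.id_comp _
  let p : ∀ n, L ⟶ J.obj n := fun n =>
    { app := fun X => (hc X).proj n
      naturality := fun X Y f => by
        refine (hc X).hom_ext fun m => ?_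
        have key : ∀ {k : ℕ}, n ≤ k → (c X).ι.app k ≫ (hc X).map (c Y) (LCFunctor.evalMap J f) ≫
            (hc Y).proj n = (c X).ι.app k ≫ (hc X).proj n ≫ (J.obj n).map f := by
          intro k hk
          obtain ⟨q, hq⟩ := hJ (homOfLE hk)
          have h1 : (c X).ι.app k ≫ (hc X).proj n ≫ (J.obj n).map f =
              (LCFunctor.evalAt C X).map q ≫ (J.obj n).map f := by
            rw [← hproj X _ q hq]
            exact (Category.assoc _ _ _).symm
          rw [h1, ← Category.assoc, (hc X).ι_map, Category.assoc, hproj Y _ q hq]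
          exact q.naturality f
        have h2 := key (le_max_left n m)
        rw [← (c X).w (homOfLE (le_max_right n m)), Category.assoc, Category.assoc]
        exact congrArg _ h2 }
  refine ⟨κ, p, fun n => ⟨LCFunctor.hom_ext fun X => ((hc X).proj_isEPPair n).1,
    fun X => ((hc X).proj_isEPPair n).2⟩, fun m n hmn X => (hc X).monotone_proj hmn, ?_, ?_⟩
  · rintro _ ⟨n, rfl⟩ X
    exact ((hc X).proj_isEPPair n).2
  · intro α hα X
    refine (hc X).isLUB_proj.2 ?_
    rintro _ ⟨n, rfl⟩
    exact hα ⟨n, rfl⟩ X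

instance [h : SupportsCanonicalFixedPoints C] : SupportsCanonicalFixedPoints (B ⥤ₒ C) where
  hasInitial := hasInitial_lcFunctor h.hasInitial
  strict := strict_lcFunctor h.strict
  cocomplete := oCocomplete_lcFunctor h.cocomplete

end FunctorCFP

end OCat

namespace OCat

/-! ### Initial algebras of endofunctors -/

/-! All five identities are instances of uniqueness of initial algebras. O-colimits of embedding
chains are colimits, and locally continuous functors preserve them, so by Adámek's argument the
colimit of `⊥ → H ⊥ → H² ⊥ → ⋯` is an initial `H`-algebra (`FixChoice.isInitialAlgebra_fixStr`).
Since `FIX` acts on transformations by algebra morphisms, `F†` is a natural family of initial `F(d,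
-)`-algebras (`FixChoice.daggerAlgebra`). Two such families are naturally isomorphic
(`ParamInitialAlgebra.iso`), whatever choices produced them.

It remains to equip the other side of each identity with the structure of a parametrized initial
algebra. The parameter identity is reindexing, composition is the rolling rule, and double dagger is
the diagonal rule: maps from `μx.μy.F(x, y)` that are algebra morphisms for `x ↦ μy.F(x, y)` are the
same as those for `x ↦ F(x, x)`. For abstraction, initial algebras computed at each `b` assemble
into one in the functor category.

The power identity needs more. Given an initial `Hⁿ`-algebra `α` on `T` with `n` positive, rolling
makes `H T` an initial `Hⁿ`-algebra too. The comparison `s : H T ⟶ T` is then an initial `H`-algebra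
whose `n`-fold iterate is `α`. Existence of `α` is a genuine input, supplied by the dagger of `Fⁿ`.
-/

/-- `α : H T ⟶ T` is an initial algebra of the endofunctor `H`. -/
def IsInitialAlgebra {K : Type u₁} [Category.{v₁} K] (H : K ⥤ K) {T : K} (α : H.obj T ⟶ T) :
    Prop :=
  ∀ ⦃X : K⦄ (a : H.obj X ⟶ X), ∃! f : T ⟶ X, α ≫ f = H.map f ≫ a

namespace IsInitialAlgebra

section

variable {K : Type u₁} [Category.{v₁} K] {H : K ⥤ K} {T : K} {α : H.obj T ⟶ T}

/-- The unique algebra morphism out of an initial algebra. -/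
noncomputable def desc (h : IsInitialAlgebra H α) {X : K} (a : H.obj X ⟶ X) : T ⟶ X :=
  (h a).choose

theorem comp_desc (h : IsInitialAlgebra H α) {X : K} (a : H.obj X ⟶ X) :
    α ≫ h.desc a = H.map (h.desc a) ≫ a :=
  (h a).choose_spec.1

theorem hom_ext (h : IsInitialAlgebra H α) {X : K} (a : H.obj X ⟶ X) {f g : T ⟶ X}
    (hf : α ≫ f = H.map f ≫ a) (hg : α ≫ g = H.map g ≫ a) : f = g :=
  (h a).unique hf hg

/-- Lambek's lemma. -/
theorem exists_inverse (h : IsInitialAlgebra H α) :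
    ∃ β : T ⟶ H.obj T, α ≫ β = 𝟙 _ ∧ β ≫ α = 𝟙 _ := by
  have h1 := h.comp_desc (H.map α)
  have h2 : h.desc (H.map α) ≫ α = 𝟙 T := by
    refine h.hom_ext α ?_ (by simp)
    rw [← Category.assoc, h1, H.map_comp]
  refine ⟨h.desc (H.map α), ?_, h2⟩
  rw [h1, ← H.map_comp, h2, H.map_id]

/-- Initiality transfers along isomorphisms of algebras. -/
theorem of_iso (h : IsInitialAlgebra H α) {S : K} {β : H.obj S ⟶ S} (u : T ⟶ S) (w : S ⟶ T)
    (huw : u ≫ w = 𝟙 T) (hwu : w ≫ u = 𝟙 S) (hu : α ≫ u = H.map u ≫ β) :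
    IsInitialAlgebra H β := by
  have hw : β ≫ w = H.map w ≫ α := by
    calc β ≫ w = H.map (w ≫ u) ≫ β ≫ w := by rw [hwu, H.map_id, Category.id_comp]
      _ = H.map w ≫ (α ≫ u) ≫ w := by rw [hu]; simp only [H.map_comp, Category.assoc]
      _ = H.map w ≫ α := by rw [Category.assoc, huw, Category.comp_id]
  intro X a
  refine ⟨w ≫ h.desc a, ?_, fun f hf => ?_⟩
  · dsimp only
    rw [← Category.assoc, hw, Category.assoc, h.comp_desc, H.map_comp, Category.assoc]
  · have : u ≫ f = h.desc a := by
      refine h.hom_ext a ?_ (h.comp_desc a)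
      rw [← Category.assoc, hu, Category.assoc, hf, H.map_comp, Category.assoc]
    rw [← this, ← Category.assoc, hwu, Category.id_comp]

/-- The image of an initial algebra under its own functor is initial. -/
theorem map_self (h : IsInitialAlgebra H α) : IsInitialAlgebra H (H.map α) := by
  obtain ⟨β, h1, h2⟩ := h.exists_inverse
  refine h.of_iso β α h2 h1 ?_
  rw [← H.map_comp, h2, H.map_id, h1]

end

/-- The rolling rule: an initial algebra of `F ∘ G` yields one of `G ∘ F`. -/
theorem roll {A : Type u₁} [Category.{v₁} A] {B : Type u₂} [Category.{v₂} B] {F : A ⥤ B}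
    {G : B ⥤ A} {T : B} {α : F.obj (G.obj T) ⟶ T} (h : IsInitialAlgebra (G ⋙ F) α) :
    IsInitialAlgebra (F ⋙ G) (T := G.obj T) (G.map α) := by
  obtain ⟨β, h1, h2⟩ := h.exists_inverse
  intro X a
  -- `F.map a` makes `F X` an algebra for `G ⋙ F`; its fold, sent through `G` and followed by `a`,
  -- is the required morphism.
  have hd := h.comp_desc (X := F.obj X) (F.map a)
  refine ⟨G.map (h.desc (X := F.obj X) (F.map a)) ≫ a, ?_, fun f hf => ?_⟩
  · change G.map α ≫ G.map _ ≫ a = G.map (F.map (G.map _ ≫ a)) ≫ a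
    rw [← Category.assoc, ← G.map_comp, hd]
    congr 2
    rw [F.map_comp]
    rfl
  · change G.map α ≫ f = G.map (F.map f) ≫ a at hf
    -- Any competitor `f` gives an algebra morphism `β ≫ F f` out of `T`, which must be the fold;
    -- applying `G` and composing with `a` recovers `f`.
    have hu : β ≫ F.map f = h.desc (X := F.obj X) (F.map a) := by
      refine h.hom_ext (F.map a) ?_ hd
      change α ≫ β ≫ F.map f = F.map (G.map (β ≫ F.map f)) ≫ F.map a
      rw [← Category.assoc, h1, ← F.map_comp, G.map_comp, Category.assoc, ← hf,
        ← Category.assoc (G.map β), ← G.map_comp, h2, G.map_id, Category.id_comp]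
      exact Category.id_comp _
    rw [← hu, G.map_comp, Category.assoc, ← hf, ← Category.assoc, ← G.map_comp, h2, G.map_id,
      Category.id_comp]

end IsInitialAlgebra

/-! ### Initial algebras of powers of an endofunctor -/

section Power

variable {K : Type u₁} [Category.{v₁} K]

/-- The `n`-th iterate `X ↦ Hⁿ X` of an endofunctor. -/
def iterate (H : K ⥤ K) : ℕ → (K ⥤ K)
  | 0 => 𝟭 K
  | n + 1 => iterate H n ⋙ H

/-- The `Hⁿ`-algebra obtained by iterating an `H`-algebra. -/
def iterateAlgebra (H : K ⥤ K) {X : K} (a : H.obj X ⟶ X) : ∀ n, (iterate H n).obj X ⟶ X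
  | 0 => 𝟙 X
  | n + 1 => H.map (iterateAlgebra H a n) ≫ a

/-- In `iterate` the new factor `H` is outermost, so the two bracketings of `Hⁿ⁺¹ X` agree only
propositionally for variable `n`. This is the source of every `eqToHom` below. -/
theorem iterate_obj_comm (H : K ⥤ K) (n : ℕ) (X : K) :
    (iterate H n).obj (H.obj X) = H.obj ((iterate H n).obj X) := by
  induction n with
  | zero => rfl
  | succ n ih => exact congrArg H.obj ih

theorem iterate_obj_iterate_obj_comm (H : K ⥤ K) (n i : ℕ) (X : K) :
    (iterate H n).obj ((iterate H i).obj X) = (iterate H i).obj ((iterate H n).obj X) := by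
  induction i with
  | zero => rfl
  | succ i ih => exact (iterate_obj_comm H n _).trans (congrArg H.obj ih)

theorem iterate_map_comm (H : K ⥤ K) (n : ℕ) {X Y : K} (f : X ⟶ Y) :
    (iterate H n).map (H.map f) ≫ eqToHom (iterate_obj_comm H n Y) =
      eqToHom (iterate_obj_comm H n X) ≫ H.map ((iterate H n).map f) := by
  induction n with
  | zero => exact (Category.comp_id _).trans (Category.id_comp _).symm
  | succ n ih =>
    have h := congrArg H.map ih
    rw [H.map_comp, H.map_comp, eqToHom_map, eqToHom_map] at h
    exact h

/-- Both sides are the `(n + 1)`-fold iterate of `a`, with one copy of `a` split off at the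
innermost or at the outermost place. -/
theorem iterate_map_comp_iterateAlgebra (H : K ⥤ K) {X : K} (a : H.obj X ⟶ X) (n : ℕ) :
    (iterate H n).map a ≫ iterateAlgebra H a n =
      eqToHom (iterate_obj_comm H n X) ≫ H.map (iterateAlgebra H a n) ≫ a := by
  induction n with
  | zero =>
    change a ≫ 𝟙 X = 𝟙 _ ≫ H.map (𝟙 X) ≫ a
    simp
  | succ n ih =>
    have h := congrArg H.map ih
    simp only [H.map_comp, eqToHom_map] at h
    change H.map ((iterate H n).map a) ≫ H.map (iterateAlgebra H a n) ≫ a =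
      eqToHom _ ≫ H.map (H.map (iterateAlgebra H a n) ≫ a) ≫ a
    rw [← Category.assoc, h, H.map_comp]
    simp only [Category.assoc]

theorem iterateAlgebra_comp (H : K ⥤ K) {X Y : K} {a : H.obj X ⟶ X} {b : H.obj Y ⟶ Y} {f : X ⟶ Y}
    (hf : a ≫ f = H.map f ≫ b) (n : ℕ) :
    iterateAlgebra H a n ≫ f = (iterate H n).map f ≫ iterateAlgebra H b n := by
  induction n with
  | zero => exact (Category.id_comp _).trans (Category.comp_id _).symm
  | succ n ih =>
    change (H.map _ ≫ a) ≫ f = H.map _ ≫ H.map _ ≫ b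
    rw [Category.assoc, hf, ← Category.assoc, ← H.map_comp, ih, H.map_comp, Category.assoc]

/-- The hypothesis says that `s` is a morphism of `Hⁿ`-algebras from `H T` to `T`. Such morphisms
survive applying `H` and composing, hence so does the iterate `Hⁱ T ⟶ T`. -/
theorem iterate_map_iterateAlgebra (H : K ⥤ K) {n : ℕ} {T : K} {α : (iterate H n).obj T ⟶ T}
    {s : H.obj T ⟶ T}
    (hs : (iterate H n).map s ≫ α = eqToHom (iterate_obj_comm H n T) ≫ H.map α ≫ s) (i : ℕ) :
    (iterate H n).map (iterateAlgebra H s i) ≫ α =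
      eqToHom (iterate_obj_iterate_obj_comm H n i T) ≫ (iterate H i).map α ≫
        iterateAlgebra H s i := by
  induction i with
  | zero =>
    change (iterate H n).map (𝟙 T) ≫ α = 𝟙 _ ≫ α ≫ 𝟙 _
    simp
  | succ i ih =>
    have h := congrArg H.map ih
    simp only [H.map_comp, eqToHom_map] at h
    change (iterate H n).map (H.map (iterateAlgebra H s i) ≫ s) ≫ α =
      eqToHom _ ≫ H.map ((iterate H i).map α) ≫ H.map (iterateAlgebra H s i) ≫ s
    rw [Functor.map_comp, Category.assoc, hs, ← Category.assoc, iterate_map_comm, Category.assoc,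
      ← Category.assoc (H.map _), h]
    simp only [Category.assoc, eqToHom_trans_assoc]

/-- `H` carries an initial `Hⁿ⁺¹`-algebra to an initial `Hⁿ⁺¹`-algebra. -/
theorem IsInitialAlgebra.iterate_shift {H : K ⥤ K} {n : ℕ} {T : K}
    {α : H.obj ((iterate H n).obj T) ⟶ T} (h : IsInitialAlgebra (iterate H n ⋙ H) α) :
    IsInitialAlgebra (iterate H (n + 1)) (T := H.obj T)
      (eqToHom (iterate_obj_comm H (n + 1) T) ≫ H.map α) := by
  -- Moving one `H` from the outermost to the innermost place prepares for the rolling rule, which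
  -- brings it back outside with carrier `H T`.
  have h' : IsInitialAlgebra (H ⋙ iterate H n) (T := T)
      (eqToHom (iterate_obj_comm H n T) ≫ α) := by
    intro X a
    obtain ⟨f, hf, hu⟩ := h (eqToHom (iterate_obj_comm H n X).symm ≫ a)
    have key : ∀ g : T ⟶ X, (eqToHom (iterate_obj_comm H n T) ≫ α) ≫ g =
        (iterate H n).map (H.map g) ≫ a ↔
        α ≫ g = H.map ((iterate H n).map g) ≫ eqToHom (iterate_obj_comm H n X).symm ≫ a := by
      intro g
      have hg : (iterate H n).map (H.map g) ≫ a = eqToHom (iterate_obj_comm H n T) ≫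
          H.map ((iterate H n).map g) ≫ eqToHom (iterate_obj_comm H n X).symm ≫ a := by
        rw [← Category.assoc, ← iterate_map_comm]
        simp
      rw [hg, Category.assoc]
      exact cancel_epi _
    exact ⟨f, (key f).2 hf, fun g hg => hu g ((key g).1 hg)⟩
  have hα : H.map (eqToHom (iterate_obj_comm H n T) ≫ α) =
      eqToHom (congrArg H.obj (iterate_obj_comm H n T)) ≫ H.map α := by
    rw [H.map_comp, eqToHom_map]
  have h2 : IsInitialAlgebra (iterate H n ⋙ H) (T := H.obj T)
      (H.map (eqToHom (iterate_obj_comm H n T) ≫ α)) := h'.roll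
  exact hα ▸ h2

/-- If `Hⁿ⁺¹` has an initial algebra, then iterating an initial `H`-algebra `n + 1` times gives
an initial `Hⁿ⁺¹`-algebra. -/
theorem IsInitialAlgebra.iterateAlgebra {H : K ⥤ K} {n : ℕ} {T : K}
    {α : (iterate H (n + 1)).obj T ⟶ T} (h : IsInitialAlgebra (iterate H (n + 1)) α) {S : K}
    {β : H.obj S ⟶ S} (hβ : IsInitialAlgebra H β) :
    IsInitialAlgebra (iterate H (n + 1)) (OCat.iterateAlgebra H β (n + 1)) := by
  have hH := h.iterate_shift
  have hs := (hH.comp_desc α).symm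
  set s := hH.desc α
  rw [Category.assoc] at hs
  -- Both are `Hⁿ⁺¹`-algebra morphisms from `Hⁿ⁺¹ T`, with structure `Hⁿ⁺¹ α`, to `T`, and the
  -- source is initial. With both exponents `n + 1` the transport is along a reflexive equality, so
  -- it is the identity.
  have hsα : OCat.iterateAlgebra H s (n + 1) = α := by
    refine h.map_self.hom_ext α ?_ rfl
    have := iterate_map_iterateAlgebra H hs (n + 1)
    rw [this]
    exact (Category.id_comp _).symm
  -- The fold `t` into the iterated algebra of `a` respects `H` because `s ≫ t` and `H t ≫ a` are
  -- both `Hⁿ⁺¹`-algebra morphisms out of the initial `H T`. Uniqueness follows from `hsα`, since an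
  -- `H`-algebra morphism respects iterates.
  have hinit : IsInitialAlgebra H s := by
    intro X a
    refine ⟨h.desc (OCat.iterateAlgebra H a (n + 1)), ?_, fun f hf => ?_⟩
    · have ht := h.comp_desc (OCat.iterateAlgebra H a (n + 1))
      set t := h.desc (OCat.iterateAlgebra H a (n + 1))
      refine hH.hom_ext (OCat.iterateAlgebra H a (n + 1)) ?_ ?_
      · rw [Functor.map_comp, Category.assoc, Category.assoc, ← ht,
          ← Category.assoc ((iterate H (n + 1)).map s), hs]
        simp only [Category.assoc]
      · rw [Functor.map_comp, Category.assoc, Category.assoc, iterate_map_comp_iterateAlgebra,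
          ← Category.assoc (H.map α), ← H.map_comp, ht,
          ← Category.assoc ((iterate H (n + 1)).map _), iterate_map_comm, H.map_comp]
        simp only [Category.assoc]
    · refine h.hom_ext (OCat.iterateAlgebra H a (n + 1)) ?_ (h.comp_desc _)
      have := iterateAlgebra_comp H hf (n + 1)
      rwa [hsα] at this
  -- The initial `H`-algebras `s` and `β` are isomorphic, and iterating the isomorphism carries `α`
  -- to the iterate of `β`.
  have hu := hinit.comp_desc β
  have hw := hβ.comp_desc s
  refine h.of_iso (hinit.desc β) (hβ.desc s) ?_ ?_ ?_
  · refine hinit.hom_ext s ?_ (by simp)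
    rw [← Category.assoc, hu, Category.assoc, hw, H.map_comp, Category.assoc]
  · refine hβ.hom_ext β ?_ (by simp)
    rw [← Category.assoc, hw, Category.assoc, hu, H.map_comp, Category.assoc]
  · have := iterateAlgebra_comp H hu (n + 1)
    rwa [hsα] at this

end Power


/-- The diagonal rule: an initial algebra of `x ↦ μ y. F(x, y)` yields one of `x ↦ F(x, x)`. -/
theorem IsInitialAlgebra.diag {B : Type u₁} [Category.{v₁} B] {F : B × B ⥤ B} {S : B ⥤ B}
    {σ : ∀ x, F.obj (x, S.obj x) ⟶ S.obj x}
    (hσ : ∀ x, IsInitialAlgebra (CategoryTheory.Prod.sectR x B ⋙ F) (σ x))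
    (hnat : ∀ {x y : B} (f : x ⟶ y),
      F.map (Prod.mkHom f (S.map f)) ≫ σ y = σ x ≫ S.map f)
    {T : B} {τ : S.obj T ⟶ T} (hτ : IsInitialAlgebra S τ) {τ' : T ⟶ S.obj T}
    (h1 : τ ≫ τ' = 𝟙 _) (h2 : τ' ≫ τ = 𝟙 _) :
    IsInitialAlgebra (Functor.diag B ⋙ F) (T := T)
      (F.map (Prod.mkHom (𝟙 T) τ') ≫ σ T ≫ τ) := by
  have hF : ∀ {x x' x'' y y' y'' : B} (f : x ⟶ x') (f' : x' ⟶ x'') (g : y ⟶ y') (g' : y' ⟶ y''),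
      F.map (Prod.mkHom f g) ≫ F.map (Prod.mkHom f' g') = F.map (Prod.mkHom (f ≫ f') (g ≫ g')) :=
    fun f f' g g' => (F.map_comp _ _).symm
  have hF1 : ∀ {x y : B}, F.map (Prod.mkHom (𝟙 x) (𝟙 y)) = 𝟙 (F.obj (x, y)) :=
    fun {x y} => F.map_id (x, y)
  intro X a
  change F.obj (X, X) ⟶ X at a
  obtain ⟨u, hu⟩ : ∃ u : S.obj X ⟶ X, σ X ≫ u = F.map (Prod.mkHom (𝟙 X) u) ≫ a :=
    ⟨(hσ X).desc (X := X) a, (hσ X).comp_desc (X := X) a⟩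
  -- With `u` the fold of `a` over `y ↦ F(X, y)`, the two kinds of algebra morphism out of `T`
  -- coincide, so initiality of `τ` is all that is needed.
  have key : ∀ t : T ⟶ X, (F.map (Prod.mkHom (𝟙 T) τ') ≫ σ T ≫ τ) ≫ t =
      F.map (Prod.mkHom t t) ≫ a ↔ τ ≫ t = S.map t ≫ u := by
    intro t
    constructor
    · intro ht
      have ht' : σ T ≫ τ ≫ t = F.map (Prod.mkHom t (τ ≫ t)) ≫ a := by
        have := congrArg (fun k => F.map (Prod.mkHom (𝟙 T) τ) ≫ k) ht
        simp only [Category.assoc] at this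
        rw [← Category.assoc, hF, h1, Category.id_comp, hF1, Category.id_comp] at this
        rw [this, ← Category.assoc, hF, Category.id_comp]
      -- Both sides are folds over `y ↦ F(T, y)` into `X`, made an algebra by reindexing `a` along
      -- `t`.
      refine (hσ T).hom_ext (X := X) (F.map (Prod.mkHom t (𝟙 X)) ≫ a) ?_ ?_
      · change σ T ≫ τ ≫ t = F.map (Prod.mkHom (𝟙 T) (τ ≫ t)) ≫ F.map (Prod.mkHom t (𝟙 X)) ≫ a
        rw [← Category.assoc (F.map _), hF, Category.id_comp, Category.comp_id, ht']
      · change σ T ≫ S.map t ≫ u =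
          F.map (Prod.mkHom (𝟙 T) (S.map t ≫ u)) ≫ F.map (Prod.mkHom t (𝟙 X)) ≫ a
        rw [← Category.assoc (F.map _), hF, Category.id_comp, Category.comp_id, ← Category.assoc,
          ← hnat, Category.assoc, hu, ← Category.assoc, hF, Category.comp_id]
    · intro ht
      simp only [Category.assoc]
      rw [ht, ← Category.assoc (σ T), ← hnat, Category.assoc, hu,
        ← Category.assoc (F.map _) (F.map _) a, hF, ← Category.assoc, hF, ← ht, ← Category.assoc τ', h2]
      simp
  obtain ⟨t, ht, htu⟩ := hτ u
  exact ⟨t, (key t).2 ht, fun f hf => htu f ((key f).1 hf)⟩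

/-! ### Canonical fixed points are initial algebras -/

section Map

variable {K : Type u₁} [Category.{v₁} K] [OCategory K] {L : Type u₂} [Category.{v₂} L]
  [OCategory L]

/-- Locally continuous functors preserve O-colimits. -/
theorem LCFunctor.isOColimit_mapCocone (F : K ⥤ₒ L) {J : ℕ ⥤ K} {c : Cocone J}
    (hc : IsOColimit c) : IsOColimit (F.toFunctor.mapCocone c) := by
  have hmap : (fun n => F.map (hc.proj n) ≫ F.map (c.ι.app n)) =
      fun n => F.map (hc.proj n ≫ c.ι.app n) := funext fun n => (F.map_comp _ _).symm
  refine ⟨fun n => F.map (hc.proj n), fun n => F.map_isEPPair (hc.proj_isEPPair n), ?_, ?_⟩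
  · change Monotone fun n => F.map (hc.proj n) ≫ F.map (c.ι.app n)
    rw [hmap]
    exact (F.lc _ _).monotone.comp hc.monotone_proj
  · change IsLUB (Set.range fun n => F.map (hc.proj n) ≫ F.map (c.ι.app n)) (𝟙 (F.obj c.pt))
    have h := F.lc _ _ (Set.range_nonempty _) hc.monotone_proj.directed_le.directedOn_range
      hc.isLUB_proj
    rw [← Set.range_comp] at h
    rw [hmap, ← F.map_id]
    exact h

end Map

/-! ### Adámek's construction for `FIX` -/

namespace FixChoice

section

variable {K : Type u₁} [Category.{v₁} K] [OCategory K]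

/-- The cocone on `⊥ → H ⊥ → H² ⊥ → ⋯` induced by an `H`-algebra. -/
def algebraι (c : FixChoice K) (H : K ⥤ₒ K) {X : K} (a : H.obj X ⟶ X) : ∀ n, c.iter H n ⟶ X
  | 0 => c.isInitial.to X
  | n + 1 => H.map (algebraι c H a n) ≫ a

theorem link_algebraι (c : FixChoice K) (H : K ⥤ₒ K) {X : K} (a : H.obj X ⟶ X) (n : ℕ) :
    c.link H n ≫ c.algebraι H a (n + 1) = c.algebraι H a n := by
  induction n with
  | zero => exact c.isInitial.hom_ext _ _
  | succ n ih =>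
    change H.map (c.link H n) ≫ H.map (c.algebraι H a (n + 1)) ≫ a =
      H.map (c.algebraι H a n) ≫ a
    rw [← Category.assoc, ← H.map_comp, ih]

end

variable {K : Type u₁} [Category.{v₁} K] [OCategory K] [SupportsCanonicalFixedPoints K]
  (c : FixChoice K)

/-- The colimit injection `Hⁿ ⊥ ⟶ FIX H`. -/
def fixι (H : K ⥤ₒ K) (n : ℕ) : c.iter H n ⟶ c.FIX.obj H := (c.fixCocone H).ι.app n

theorem link_fixι (H : K ⥤ₒ K) (n : ℕ) : c.link H n ≫ c.fixι H (n + 1) = c.fixι H n := by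
  have h := (c.fixCocone H).w (homOfLE (Nat.le_add_right n 1))
  simp only [chain, Functor.ofSequence_map_homOfLE_succ] at h
  exact h

theorem FIX_hom_ext {H : K ⥤ₒ K} {X : K} {f g : c.FIX.obj H ⟶ X}
    (h : ∀ n, c.fixι H n ≫ f = c.fixι H n ≫ g) : f = g :=
  (c.isOColimit_fixCocone H).hom_ext h

theorem fixι_map {H H' : K ⥤ₒ K} (η : H ⟶ H') (n : ℕ) :
    c.fixι H n ≫ c.FIX.map η = c.iterMap η n ≫ c.fixι H' n :=
  (c.isOColimit_fixCocone H).ι_map (c.fixCocone H') (c.chainMap η) n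

/-- `F` preserves the O-colimit, so the images of the injections are jointly epimorphic. -/
theorem map_FIX_hom_ext {L : Type u₂} [Category.{v₂} L] [OCategory L] {H : K ⥤ₒ K} (F : K ⥤ₒ L)
    {X : L} {f g : F.obj (c.FIX.obj H) ⟶ X}
    (h : ∀ n, F.map (c.fixι H n) ≫ f = F.map (c.fixι H n) ≫ g) : f = g :=
  (F.isOColimit_mapCocone (c.isOColimit_fixCocone H)).hom_ext h

theorem exists_fixStr (H : K ⥤ₒ K) : ∃ α : H.obj (c.FIX.obj H) ⟶ c.FIX.obj H,
    ∀ n, H.map (c.fixι H n) ≫ α = c.fixι H (n + 1) := by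
  -- `H` shifts the chain by one place, so the injections from index 1 onwards form a cocone on its
  -- image.
  let s : c.chain H ⋙ H.toFunctor ⟶ (Functor.const ℕ).obj (c.FIX.obj H) :=
    NatTrans.ofSequence (fun n => c.fixι H (n + 1)) fun n => by
      simp only [chain, Functor.comp_map, Functor.ofSequence_map_homOfLE_succ]
      exact (c.link_fixι H (n + 1)).trans (Category.comp_id _).symm
  have h := H.isOColimit_mapCocone (c.isOColimit_fixCocone H)
  exact ⟨h.med s, h.fac s⟩

/-- The structure map `H (FIX H) ⟶ FIX H`. -/
noncomputable def fixStr (H : K ⥤ₒ K) : H.obj (c.FIX.obj H) ⟶ c.FIX.obj H :=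
  (c.exists_fixStr H).choose

theorem map_fixι_fixStr (H : K ⥤ₒ K) (n : ℕ) :
    H.map (c.fixι H n) ≫ c.fixStr H = c.fixι H (n + 1) :=
  (c.exists_fixStr H).choose_spec n

theorem map_fixι_fixStr_comp (H : K ⥤ₒ K) {X : K} (f : c.FIX.obj H ⟶ X) (n : ℕ) :
    H.map (c.fixι H n) ≫ c.fixStr H ≫ f = c.fixι H (n + 1) ≫ f :=
  (Category.assoc _ _ _).symm.trans (congrArg (fun k => k ≫ f) (c.map_fixι_fixStr H n))

/-- `FIX H` is an initial `H`-algebra. -/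
theorem isInitialAlgebra_fixStr (H : K ⥤ₒ K) : IsInitialAlgebra H.toFunctor (c.fixStr H) := by
  intro X a
  let s : c.chain H ⟶ (Functor.const ℕ).obj X :=
    NatTrans.ofSequence (c.algebraι H a) fun n => by
      simp only [chain, Functor.ofSequence_map_homOfLE_succ]
      exact (c.link_algebraι H a n).trans (Category.comp_id _).symm
  obtain ⟨f, hs⟩ : ∃ f : c.FIX.obj H ⟶ X, ∀ n, c.fixι H n ≫ f = c.algebraι H a n :=
    ⟨(c.isOColimit_fixCocone H).med s, (c.isOColimit_fixCocone H).fac s⟩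
  refine ⟨f, ?_, fun g hg => c.FIX_hom_ext fun n => ?_⟩
  · refine c.map_FIX_hom_ext H fun n => ?_
    rw [← Category.assoc (H.map _) (H.map _), ← H.map_comp, hs]
    exact (c.map_fixι_fixStr_comp H f n).trans (hs (n + 1))
  -- The restriction of an algebra morphism to `Hⁿ ⊥` is forced: at `0` by initiality of `⊥`,
  -- afterwards by the algebra equation.
  · rw [hs]
    induction n with
    | zero => exact c.isInitial.hom_ext _ _
    | succ n ih =>
      refine (c.map_fixι_fixStr_comp H g n).symm.trans ?_
      refine (congrArg (fun k => H.map (c.fixι H n) ≫ k) hg).trans ?_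
      rw [← Category.assoc, ← H.map_comp, ih]
      rfl

/-- `FIX η` is the fold into `FIX H'` regarded as an `H`-algebra through `η`. On each stage this is
the recursion defining `η⁽ⁿ⁺¹⁾` together with naturality of `η`. It yields naturality of the dagger
structure both in the parameter and in the functor. -/
theorem fixStr_naturality {H H' : K ⥤ₒ K} (η : H ⟶ H') :
    c.fixStr H ≫ c.FIX.map η =
      H.map (c.FIX.map η) ≫ η.app (c.FIX.obj H') ≫ c.fixStr H' := by
  refine c.map_FIX_hom_ext H fun n => ?_
  have hη : H.map (c.fixι H' n) ≫ η.app (c.FIX.obj H') =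
      η.app (c.iter H' n) ≫ H'.map (c.fixι H' n) := η.naturality _
  refine (c.map_fixι_fixStr_comp H _ n).trans ((c.fixι_map η (n + 1)).trans ?_)
  rw [← Category.assoc (H.map _), ← H.map_comp, fixι_map, H.map_comp, Category.assoc,
    ← Category.assoc (H.map (c.fixι H' n)), hη, Category.assoc, map_fixι_fixStr]
  exact Category.assoc _ _ _

end FixChoice


/-! ### Parametrized initial algebras -/

open LCFunctor

section Parametrized

variable {D : Type u₁} [Category.{v₁} D] [OCategory D] {K : Type u₂} [Category.{v₂} K]
  [OCategory K]

/-- A natural family of initial algebras `F(d, T d) ⟶ T d` of the functors `F(d, -)`. -/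
structure ParamInitialAlgebra (F : D × K ⥤ₒ K) (T : D ⥤ₒ K) where
  str : ∀ d, F.obj (d, T.obj d) ⟶ T.obj d
  naturality : ∀ {d d' : D} (g : d ⟶ d'),
    F.map (Prod.mkHom g (T.map g)) ≫ str d' = str d ≫ T.map g
  existsUnique : ∀ (d : D) {X : K} (a : F.obj (d, X) ⟶ X),
    ∃! f : T.obj d ⟶ X, str d ≫ f = F.map (Prod.mkHom (𝟙 d) f) ≫ a

theorem LCFunctor.map_mkHom_comp {A : Type u₃} [Category.{v₃} A] [OCategory A] (F : D × K ⥤ₒ A)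
    {d d' d'' : D} {x x' x'' : K} (f : d ⟶ d') (f' : d' ⟶ d'') (g : x ⟶ x') (g' : x' ⟶ x'') :
    F.map (Prod.mkHom f g) ≫ F.map (Prod.mkHom f' g') =
      F.map (Prod.mkHom (f ≫ f') (g ≫ g')) :=
  (F.map_comp _ _).symm

theorem LCFunctor.map_mkHom_comp_assoc {A : Type u₃} [Category.{v₃} A] [OCategory A]
    (F : D × K ⥤ₒ A) {d d' d'' : D} {x x' x'' : K} (f : d ⟶ d') (f' : d' ⟶ d'') (g : x ⟶ x')
    (g' : x' ⟶ x'') {Z : A} (h : F.obj (d'', x'') ⟶ Z) :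
    F.map (Prod.mkHom f g) ≫ F.map (Prod.mkHom f' g') ≫ h =
      F.map (Prod.mkHom (f ≫ f') (g ≫ g')) ≫ h := by
  rw [← map_mkHom_comp, Category.assoc]

theorem LCFunctor.map_mkHom_id {A : Type u₃} [Category.{v₃} A] [OCategory A] (F : D × K ⥤ₒ A)
    (d : D) (x : K) : F.map (Prod.mkHom (𝟙 d) (𝟙 x)) = 𝟙 (F.obj (d, x)) :=
  F.map_id (d, x)

namespace ParamInitialAlgebra

variable {F : D × K ⥤ₒ K} {T S : D ⥤ₒ K} (α : ParamInitialAlgebra F T)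
  (β : ParamInitialAlgebra F S)

theorem hom_ext (d : D) {X : K} (a : F.obj (d, X) ⟶ X)
    {f g : T.obj d ⟶ X} (hf : α.str d ≫ f = F.map (Prod.mkHom (𝟙 d) f) ≫ a)
    (hg : α.str d ≫ g = F.map (Prod.mkHom (𝟙 d) g) ≫ a) : f = g :=
  (α.existsUnique d a).unique hf hg

/-- Both composites are folds over `F(d, -)` into `X'` with structure `F(g, 𝟙) ≫ x'`. This gives
naturality of all maps defined pointwise as folds. -/
theorem map_comp_eq_comp {d d' : D} (g : d ⟶ d') {X X' : K} {x : F.obj (d, X) ⟶ X}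
    {x' : F.obj (d', X') ⟶ X'} {k : X ⟶ X'} (hk : F.map (Prod.mkHom g k) ≫ x' = x ≫ k)
    {u : T.obj d ⟶ X} {u' : T.obj d' ⟶ X'}
    (hu : α.str d ≫ u = F.map (Prod.mkHom (𝟙 d) u) ≫ x)
    (hu' : α.str d' ≫ u' = F.map (Prod.mkHom (𝟙 d') u') ≫ x') : T.map g ≫ u' = u ≫ k := by
  refine α.hom_ext d (F.map (Prod.mkHom g (𝟙 _)) ≫ x') ?_ ?_
  · rw [← Category.assoc, ← α.naturality g, Category.assoc, hu', map_mkHom_comp_assoc,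
      map_mkHom_comp_assoc]
    simp only [Category.comp_id, Category.id_comp]
  · rw [← Category.assoc, hu, Category.assoc, ← hk, map_mkHom_comp_assoc, map_mkHom_comp_assoc]
    simp only [Category.comp_id, Category.id_comp]

/-- The components of the comparison of two parametrized initial algebras. -/
noncomputable def homApp (d : D) : T.obj d ⟶ S.obj d := (α.existsUnique d (β.str d)).choose

theorem comp_homApp (d : D) :
    α.str d ≫ α.homApp β d = F.map (Prod.mkHom (𝟙 d) (α.homApp β d)) ≫ β.str d :=
  (α.existsUnique d (β.str d)).choose_spec.1

theorem homApp_naturality {d d' : D} (g : d ⟶ d') :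
    T.map g ≫ α.homApp β d' = α.homApp β d ≫ S.map g :=
  α.map_comp_eq_comp g (β.naturality g) (α.comp_homApp β d) (α.comp_homApp β d')

theorem homApp_comp_homApp (d : D) : α.homApp β d ≫ β.homApp α d = 𝟙 (T.obj d) := by
  refine α.hom_ext d (α.str d) ?_ ?_
  · rw [← Category.assoc, comp_homApp, Category.assoc, comp_homApp, map_mkHom_comp_assoc,
      Category.comp_id]
  · rw [map_mkHom_id, Category.comp_id, Category.id_comp]

/-- Parametrized initial algebras are unique up to natural isomorphism. -/
noncomputable def iso : T ≅ S where
  hom := NatTrans.mk (F := T.toFunctor) (α.homApp β) fun _ _ => α.homApp_naturality β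
  inv := NatTrans.mk (F := S.toFunctor) (β.homApp α) fun _ _ => β.homApp_naturality α
  hom_inv_id := LCFunctor.hom_ext (α.homApp_comp_homApp β)
  inv_hom_id := LCFunctor.hom_ext (β.homApp_comp_homApp α)

/-- The comparison is natural in the functor. -/
theorem iso_hom_naturality {G : D × K ⥤ₒ K} (η : F ⟶ G) {T' S' : D ⥤ₒ K}
    (α' : ParamInitialAlgebra G T') (β' : ParamInitialAlgebra G S') {t : T ⟶ T'} {s : S ⟶ S'}
    (ht : ∀ d, α.str d ≫ t.app d =
      F.map (Prod.mkHom (𝟙 d) (t.app d)) ≫ η.app (d, T'.obj d) ≫ α'.str d)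
    (hs : ∀ d, β.str d ≫ s.app d =
      F.map (Prod.mkHom (𝟙 d) (s.app d)) ≫ η.app (d, S'.obj d) ≫ β'.str d) :
    t ≫ (α'.iso β').hom = (α.iso β).hom ≫ s := by
  refine LCFunctor.hom_ext fun d => α.hom_ext d (η.app (d, S'.obj d) ≫ β'.str d) ?_ ?_
  · change α.str d ≫ t.app d ≫ α'.homApp β' d =
      F.map (Prod.mkHom (𝟙 d) (t.app d ≫ α'.homApp β' d)) ≫ _
    have hη : η.app (d, T'.obj d) ≫ G.map (Prod.mkHom (𝟙 d) (α'.homApp β' d)) =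
        F.map (Prod.mkHom (𝟙 d) (α'.homApp β' d)) ≫ η.app (d, S'.obj d) :=
      (η.naturality _).symm
    rw [← Category.assoc, ht]
    simp only [Category.assoc]
    rw [comp_homApp, ← Category.assoc (η.app _), hη, Category.assoc, map_mkHom_comp_assoc,
      Category.comp_id]
  · change α.str d ≫ α.homApp β d ≫ s.app d =
      F.map (Prod.mkHom (𝟙 d) (α.homApp β d ≫ s.app d)) ≫ _
    rw [← Category.assoc, comp_homApp, Category.assoc, hs, map_mkHom_comp_assoc,
      Category.comp_id]

theorem isInitialAlgebra (d : D) :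
    IsInitialAlgebra (F.partialApp d).toFunctor (T := T.obj d) (α.str d) :=
  fun _ a => α.existsUnique d a

theorem exists_inverse (d : D) : ∃ β : T.obj d ⟶ F.obj (d, T.obj d),
    α.str d ≫ β = 𝟙 _ ∧ β ≫ α.str d = 𝟙 _ :=
  (α.isInitialAlgebra d).exists_inverse

/-- The inverse of the structure map. -/
noncomputable def inv (d : D) : T.obj d ⟶ F.obj (d, T.obj d) := (α.exists_inverse d).choose

theorem str_inv (d : D) : α.str d ≫ α.inv d = 𝟙 _ := (α.exists_inverse d).choose_spec.1

theorem inv_str (d : D) : α.inv d ≫ α.str d = 𝟙 _ := (α.exists_inverse d).choose_spec.2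

theorem inv_naturality {d d' : D} (g : d ⟶ d') :
    T.map g ≫ α.inv d' = α.inv d ≫ F.map (Prod.mkHom g (T.map g)) := by
  calc T.map g ≫ α.inv d' = α.inv d ≫ (α.str d ≫ T.map g) ≫ α.inv d' := by
        rw [Category.assoc, ← Category.assoc, α.inv_str, Category.id_comp]
    _ = α.inv d ≫ F.map (Prod.mkHom g (T.map g)) := by
        rw [← α.naturality, Category.assoc, α.str_inv, Category.comp_id]

end ParamInitialAlgebra

end Parametrized

/-! ### Daggers as parametrized initial algebras -/

namespace FixChoice

variable {D : Type u₁} [Category.{v₁} D] [OCategory D] {K : Type u₂} [Category.{v₂} K]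
  [OCategory K] [SupportsCanonicalFixedPoints K] (c : FixChoice K)

/-- The structure map `F(d, F† d) ⟶ F† d`. -/
noncomputable def daggerStr (F : D × K ⥤ₒ K) (d : D) :
    F.obj (d, (c.dagger F).obj d) ⟶ (c.dagger F).obj d :=
  c.fixStr (F.partialApp d)

/-- `F†` acts on `g` as `FIX` of the transformation `F(g, -)`, so naturality of `fixStr` applies. -/
theorem daggerStr_map (F : D × K ⥤ₒ K) {d d' : D} (g : d ⟶ d') :
    F.map (Prod.mkHom g ((c.dagger F).map g)) ≫ c.daggerStr F d' =
      c.daggerStr F d ≫ (c.dagger F).map g := by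
  have h : c.daggerStr F d ≫ (c.dagger F).map g =
      F.map (Prod.mkHom (𝟙 d) ((c.dagger F).map g)) ≫
        F.map (Prod.mkHom g (𝟙 ((c.dagger F).obj d'))) ≫ c.daggerStr F d' :=
    c.fixStr_naturality (F.curry.map g)
  rw [h, map_mkHom_comp_assoc, Category.id_comp, Category.comp_id]

/-- The dagger is a parametrized initial algebra. -/
noncomputable def daggerAlgebra (F : D × K ⥤ₒ K) : ParamInitialAlgebra F (c.dagger F) where
  str := c.daggerStr F
  naturality := c.daggerStr_map F
  existsUnique d _ a := c.isInitialAlgebra_fixStr (F.partialApp d) a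

theorem daggerStr_naturality {F G : D × K ⥤ₒ K} (η : F ⟶ G) (d : D) :
    c.daggerStr F d ≫ ((c.daggerFunctor D).map η).app d =
      F.map (Prod.mkHom (𝟙 d) (((c.daggerFunctor D).map η).app d)) ≫
        η.app (d, (c.dagger G).obj d) ≫ c.daggerStr G d :=
  c.fixStr_naturality (((curryFunctor D K K).map η).app d)

end FixChoice


/-! ### The Conway and power identities for parametrized initial algebras -/

namespace ParamInitialAlgebra

/-! ### Parameter and composition identities -/

section Reindex

variable {A : Type u₁} [Category.{v₁} A] [OCategory A] {B : Type u₂} [Category.{v₂} B]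
  [OCategory B] {C : Type u₃} [Category.{v₃} C] [OCategory C]

/-- Reindexing a parametrized initial algebra along a functor. -/
def reindex {F : B × C ⥤ₒ C} {T : B ⥤ₒ C} (α : ParamInitialAlgebra F T) (G : A ⥤ₒ B) :
    ParamInitialAlgebra ((prodMap G (LCFunctor.id C)).comp F) (G.comp T) where
  str d := α.str (G.obj d)
  naturality g := α.naturality (G.map g)
  existsUnique d X a := by
    have h : ∀ f : T.obj (G.obj d) ⟶ X,
        ((prodMap G (LCFunctor.id C)).comp F).map (Prod.mkHom (𝟙 d) f) =
          F.map (Prod.mkHom (𝟙 (G.obj d)) f) :=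
      fun f => congrArg (fun k => F.map (Prod.mkHom k f)) (G.map_id d)
    obtain ⟨f, hf, hu⟩ := α.existsUnique (G.obj d) a
    exact ⟨f, hf.trans (congrArg (fun k => k ≫ a) (h f).symm),
      fun g hg => hu g (Eq.trans hg (congrArg (fun k => k ≫ a) (h g)))⟩

/-- The parametrized rolling rule. -/
def roll {P : Type u₄} [Category.{v₄} P] [OCategory P] {F : P × A ⥤ₒ B} {G : P × B ⥤ₒ A}
    {T : P ⥤ₒ B} (α : ParamInitialAlgebra ((pair (fst P B) G).comp F) T) :
    ParamInitialAlgebra ((pair (fst P A) F).comp G) ((pair (LCFunctor.id P) T).comp G) where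
  str p := G.map (Prod.mkHom (𝟙 p) (α.str p))
  naturality {p p'} g := by
    have h : F.map (Prod.mkHom g (G.map (Prod.mkHom g (T.map g)))) ≫ α.str p' =
        α.str p ≫ T.map g := α.naturality g
    change G.map (Prod.mkHom g (F.map (Prod.mkHom g (G.map (Prod.mkHom g (T.map g)))))) ≫
      G.map (Prod.mkHom (𝟙 p') (α.str p')) =
        G.map (Prod.mkHom (𝟙 p) (α.str p)) ≫ G.map (Prod.mkHom g (T.map g))
    refine (map_mkHom_comp G _ _ _ _).trans (Eq.trans ?_ (map_mkHom_comp G _ _ _ _).symm)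
    rw [Category.comp_id, Category.id_comp]
    exact congrArg (fun k => G.map (Prod.mkHom g k)) h
  existsUnique p X a := by
    -- For fixed `p` the functor is definitionally a composite of partial applications, so the
    -- unparametrized rule applies.
    have h : IsInitialAlgebra ((G.partialApp p).toFunctor ⋙ (F.partialApp p).toFunctor)
      (α.str p) := α.isInitialAlgebra p
    exact h.roll a

end Reindex

/-! ### Double dagger and power identities -/

section Diagonal

variable {A : Type u₁} [Category.{v₁} A] [OCategory A] {B : Type u₂} [Category.{v₂} B]
  [OCategory B]

/-- The square is pasted from those of `τ⁻¹`, `s` and `τ`. -/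
theorem diag_naturality {F : A × (B × B) ⥤ₒ B} {S : A × B ⥤ₒ B} {T : A ⥤ₒ B}
    (τ : ParamInitialAlgebra S T)
    (s : ∀ a, F.obj (a, (T.obj a, S.obj (a, T.obj a))) ⟶ S.obj (a, T.obj a)) {a a' : A}
    (g : a ⟶ a')
    (hs : F.map (Prod.mkHom g (Prod.mkHom (T.map g) (S.map (Prod.mkHom g (T.map g))))) ≫ s a' =
      s a ≫ S.map (Prod.mkHom g (T.map g))) :
    F.map (Prod.mkHom g (Prod.mkHom (T.map g) (T.map g))) ≫
        F.map (Prod.mkHom (𝟙 a') (Prod.mkHom (𝟙 (T.obj a')) (τ.inv a'))) ≫ s a' ≫ τ.str a' =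
      (F.map (Prod.mkHom (𝟙 a) (Prod.mkHom (𝟙 (T.obj a)) (τ.inv a))) ≫ s a ≫ τ.str a) ≫
        T.map g := by
  have h : Prod.mkHom (T.map g) (T.map g) ≫ Prod.mkHom (𝟙 (T.obj a')) (τ.inv a') =
      Prod.mkHom (𝟙 (T.obj a)) (τ.inv a) ≫
        Prod.mkHom (T.map g) (S.map (Prod.mkHom g (T.map g))) := by
    refine Prod.ext ?_ (τ.inv_naturality g)
    exact (Category.comp_id _).trans (Category.id_comp _).symm
  rw [map_mkHom_comp_assoc, h, Category.comp_id, Category.assoc, Category.assoc, ← τ.naturality,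
    ← Category.assoc (s a), ← hs, Category.assoc, map_mkHom_comp_assoc, Category.id_comp]

/-- The parametrized diagonal rule. -/
noncomputable def diag {F : A × (B × B) ⥤ₒ B} {S : A × B ⥤ₒ B} {T : A ⥤ₒ B}
    (σ : ParamInitialAlgebra ((assoc A B B).comp F) S) (τ : ParamInitialAlgebra S T) :
    ParamInitialAlgebra
      ((prodMap (LCFunctor.id A) (pair (LCFunctor.id B) (LCFunctor.id B))).comp F) T where
  str a := F.map (Prod.mkHom (𝟙 a) (Prod.mkHom (𝟙 (T.obj a)) (τ.inv a))) ≫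
    σ.str (a, T.obj a) ≫ τ.str a
  naturality g := diag_naturality τ (fun a => σ.str (a, T.obj a)) g
    (σ.naturality (Prod.mkHom g (T.map g)))
  existsUnique a X f := by
    have h := IsInitialAlgebra.diag (F := (F.partialApp a).toFunctor)
      (S := (S.partialApp a).toFunctor) (σ := fun x => σ.str (a, x))
      (fun x => σ.isInitialAlgebra (a, x)) (fun f => σ.naturality (Prod.mkHom (𝟙 a) f))
      (τ.isInitialAlgebra a) (τ.str_inv a) (τ.inv_str a)
    exact h f

/-- The structure map of the power `Fⁿ` on a parametrized algebra of `F`. -/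
def powerStr {F : A × B ⥤ₒ B} {T : A ⥤ₒ B} (α : ParamInitialAlgebra F T) (a : A) :
    ∀ n, (F.power n).obj (a, T.obj a) ⟶ T.obj a
  | 0 => 𝟙 _
  | n + 1 => F.map (Prod.mkHom (𝟙 a) (powerStr α a n)) ≫ α.str a

theorem powerStr_naturality {F : A × B ⥤ₒ B} {T : A ⥤ₒ B} (α : ParamInitialAlgebra F T)
    {a a' : A} (g : a ⟶ a') (n : ℕ) :
    (F.power n).map (Prod.mkHom g (T.map g)) ≫ α.powerStr a' n = α.powerStr a n ≫ T.map g := by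
  induction n with
  | zero => exact (Category.comp_id _).trans (Category.id_comp _).symm
  | succ n ih =>
    change F.map (Prod.mkHom g ((F.power n).map (Prod.mkHom g (T.map g)))) ≫
      F.map (Prod.mkHom (𝟙 a') (α.powerStr a' n)) ≫ α.str a' =
        (F.map (Prod.mkHom (𝟙 a) (α.powerStr a n)) ≫ α.str a) ≫ T.map g
    rw [map_mkHom_comp_assoc, Category.assoc, ← α.naturality, map_mkHom_comp_assoc, ih,
      Category.comp_id, Category.id_comp]

theorem power_partialApp {F : A × B ⥤ₒ B} {T : A ⥤ₒ B} (α : ParamInitialAlgebra F T) (a : A)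
    (n : ℕ) : ((F.power n).partialApp a).toFunctor = iterate (F.partialApp a).toFunctor n ∧
      HEq (α.powerStr a n) (iterateAlgebra (F.partialApp a).toFunctor (α.str a) n) := by
  -- Generalizing the inner functors to variables lets their equality be substituted, which removes
  -- the heterogeneous equality.
  have step : ∀ (Q Q' H : B ⥤ B) {X : B} (f : H.obj X ⟶ X) (q : Q.obj X ⟶ X) (q' : Q'.obj X ⟶ X),
      Q = Q' → HEq q q' → (Q ⋙ H = Q' ⋙ H ∧ HEq (H.map q ≫ f) (H.map q' ≫ f)) := by
    rintro Q _ H X f q _ rfl ⟨⟩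
    exact ⟨rfl, HEq.rfl⟩
  induction n with
  | zero => exact ⟨rfl, HEq.rfl⟩
  | succ n ih => exact step _ _ (F.partialApp a).toFunctor (α.str a) _ _ ih.1 ih.2

/-- If `Fⁿ⁺¹` has a parametrized initial algebra, then the one of `F` is one of `Fⁿ⁺¹`. -/
def power {F : A × B ⥤ₒ B} {T S : A ⥤ₒ B} (α : ParamInitialAlgebra F T) (n : ℕ)
    (β : ParamInitialAlgebra (F.power (n + 1)) S) : ParamInitialAlgebra (F.power (n + 1)) T where
  str a := α.powerStr a (n + 1)
  naturality g := α.powerStr_naturality g (n + 1)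
  existsUnique a X f := by
    have transfer : ∀ (Q Q' : B ⥤ B) {X : B} (q : Q.obj X ⟶ X) (q' : Q'.obj X ⟶ X),
        Q = Q' → HEq q q' → IsInitialAlgebra Q' q' → IsInitialAlgebra Q q := by
      rintro Q _ X q _ rfl ⟨⟩ h
      exact h
    obtain ⟨h1, h2⟩ := α.power_partialApp a (n + 1)
    -- From `β` only the existence of some initial algebra of the iterate is kept.
    have hβ : ∃ (Y : B) (y : (iterate (F.partialApp a).toFunctor (n + 1)).obj Y ⟶ Y),
        IsInitialAlgebra (iterate (F.partialApp a).toFunctor (n + 1)) y :=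
      h1 ▸ ⟨_, _, β.isInitialAlgebra a⟩
    obtain ⟨Y, y, hy⟩ := hβ
    exact transfer _ _ _ _ h1 h2 (hy.iterateAlgebra (α.isInitialAlgebra a)) f

end Diagonal

/-! ### Abstraction identity -/

section Abstraction

variable {A : Type u₁} [Category.{v₁} A] [OCategory A] {B : Type u₂} [Category.{v₂} B]
  [OCategory B] {C : Type u₃} [Category.{v₃} C] [OCategory C]

/-- The functor `(a, H) ↦ (b ↦ F(a, b, H b))`. -/
abbrev absFunctor (F : A × (B × C) ⥤ₒ C) : A × (B ⥤ₒ C) ⥤ₒ (B ⥤ₒ C) :=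
  ((assoc A (B ⥤ₒ C) B).comp
    ((prodMap (LCFunctor.id A) (pair (snd (B ⥤ₒ C) B) (ev B C))).comp F)).curry

theorem absFunctor_obj_map (F : A × (B × C) ⥤ₒ C) (a : A) (H : B ⥤ₒ C) {b b' : B} (h : b ⟶ b') :
    ((absFunctor F).obj (a, H)).map h = F.map (Prod.mkHom (𝟙 a) (Prod.mkHom h (H.map h))) :=
  congrArg (fun k => F.map (Prod.mkHom (𝟙 a) (Prod.mkHom h k))) (Category.comp_id (H.map h))

/-- Evaluation sends `(θ, 𝟙 b)` to `H (𝟙 b) ≫ θ b`, whose first factor is an identity only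
propositionally. -/
theorem absFunctor_map_app (F : A × (B × C) ⥤ₒ C) {a a' : A} (g : a ⟶ a') {H H' : B ⥤ₒ C}
    (θ : H ⟶ H') (b : B) :
    ((absFunctor F).map (Prod.mkHom g θ)).app b =
      F.map (Prod.mkHom g (Prod.mkHom (𝟙 b) (θ.app b))) :=
  congrArg (fun k => F.map (Prod.mkHom g (Prod.mkHom (𝟙 b) k)))
    ((congrArg (fun k => k ≫ θ.app b) (H.map_id b)).trans (Category.id_comp _))

/-- Pointwise initial algebras form an initial algebra in the functor category. -/
noncomputable def abstraction {F : A × (B × C) ⥤ₒ C} {T : A × B ⥤ₒ C}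
    (α : ParamInitialAlgebra ((assoc A B C).comp F) T) :
    ParamInitialAlgebra (absFunctor F) T.curry where
  str a := NatTrans.mk (F := ((absFunctor F).obj (a, T.curry.obj a)).toFunctor)
    (G := (T.curry.obj a).toFunctor) (fun b => α.str (a, b)) fun b b' h =>
      (congrArg (fun k => k ≫ α.str (a, b')) (absFunctor_obj_map F a _ h)).trans
        (α.naturality (Prod.mkHom (𝟙 a) h))
  naturality {a a'} g := LCFunctor.hom_ext fun b =>
    (congrArg (fun k => k ≫ α.str (a', b)) (absFunctor_map_app F g _ b)).trans
      (α.naturality (Prod.mkHom g (𝟙 b)))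
  existsUnique a X f := by
    have hX : ∀ {b b' : B} (h : b ⟶ b'), F.map (Prod.mkHom (𝟙 a) (Prod.mkHom h (X.map h))) ≫
        (f.app b' : F.obj (a, (b', X.obj b')) ⟶ X.obj b') = f.app b ≫ X.map h := fun h =>
      (congrArg (fun k => k ≫ f.app _) (absFunctor_obj_map F a X h)).symm.trans (f.naturality h)
    -- Each component of `f` is an algebra of `F(a, b, -)` on `X b`, so the mediating morphism is
    -- forced componentwise; its naturality is `map_comp_eq_comp` along `X h`.
    choose u hu huniq using fun b => α.existsUnique (a, b) (X := X.obj b) (f.app b)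
    let w : T.curry.obj a ⟶ X :=
      NatTrans.mk (F := (T.curry.obj a).toFunctor) (G := X.toFunctor) u fun b b' h =>
        α.map_comp_eq_comp (Prod.mkHom (𝟙 a) h) (hX h) (hu b) (hu b')
    refine ⟨w, LCFunctor.hom_ext fun b => (hu b).trans ?_,
      fun v hv => LCFunctor.hom_ext fun b => huniq b _ ?_⟩
    · exact (congrArg (fun k => k ≫ f.app b) (absFunctor_map_app F (𝟙 a) w b)).symm
    · exact (congrArg (fun k : _ ⟶ X => k.app b) hv).trans
        (congrArg (fun k => k ≫ f.app b) (absFunctor_map_app F (𝟙 a) v b))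

end Abstraction

end ParamInitialAlgebra

/-- The abstraction identity, as a natural isomorphism of functors. -/
noncomputable def abstractionIso (A : Type u₁) [Category.{v₁} A] [OCategory A] (B : Type u₂)
    [Category.{v₂} B] [OCategory B] (C : Type u₃) [Category.{v₃} C] [OCategory C]
    [SupportsCanonicalFixedPoints C] (c : FixChoice C) (e : FixChoice (B ⥤ₒ C)) :
    precomp C (assoc A B C) ⋙ c.daggerFunctor (A × B) ⋙ curryFunctor A B C ≅
      precomp C (prodMap (LCFunctor.id A) (pair (snd (B ⥤ₒ C) B) (ev B C))) ⋙
        precomp C (assoc A (B ⥤ₒ C) B) ⋙ curryFunctor (A × (B ⥤ₒ C)) B C ⋙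
          e.daggerFunctor A :=
  NatIso.ofComponents
    (fun F => (c.daggerAlgebra ((assoc A B C).comp F)).abstraction.iso
      (e.daggerAlgebra (ParamInitialAlgebra.absFunctor F)))
    fun {F G} η => by
      -- Naturality in `F` reduces to both functors acting on `η` by algebra morphisms; on the
      -- pointwise side this is checked at each `b`.
      refine ParamInitialAlgebra.iso_hom_naturality _ _
        ((precomp C (prodMap (LCFunctor.id A) (pair (snd (B ⥤ₒ C) B) (ev B C))) ⋙
          precomp C (assoc A (B ⥤ₒ C) B) ⋙ curryFunctor (A × (B ⥤ₒ C)) B C).map η) _ _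
        (fun a => LCFunctor.hom_ext fun b => ?_) (fun a => e.daggerStr_naturality _ a)
      refine (c.daggerStr_naturality ((precomp C (assoc A B C)).map η) (a, b)).trans ?_
      exact congrArg (fun k => k ≫ η.app (a, (b, (c.dagger ((assoc A B C).comp G)).obj (a, b))) ≫
          c.daggerStr ((assoc A B C).comp G) (a, b))
        (ParamInitialAlgebra.absFunctor_map_app F (𝟙 a)
          ((curryFunctor A B C).map ((c.daggerFunctor (A × B)).map
            ((precomp C (assoc A B C)).map η)) |>.app a) b).symm

end OCat

open OCat OCat.LCFunctor in
theorem theorem1 :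
    -- parameter identity
    (∀ (A : Type u₁) [Category.{v₁} A] [OCategory A] (B : Type u₂) [Category.{v₂} B] [OCategory B]
      (C : Type u₃) [Category.{v₃} C] [OCategory C] [SupportsCanonicalFixedPoints C]
      (c : FixChoice C) (F : B × C ⥤ₒ C) (G : A ⥤ₒ B),
      Nonempty (c.dagger ((prodMap G (LCFunctor.id C)).comp F) ≅ G.comp (c.dagger F))) ∧
    -- composition identity (parametrized dinaturality)
    (∀ (P : Type u₁) [Category.{v₁} P] [OCategory P]
      (A : Type u₂) [Category.{v₂} A] [OCategory A] [SupportsCanonicalFixedPoints A]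
      (B : Type u₃) [Category.{v₃} B] [OCategory B] [SupportsCanonicalFixedPoints B]
      (a : FixChoice A) (b : FixChoice B) (F : P × A ⥤ₒ B) (G : P × B ⥤ₒ A),
      Nonempty (a.dagger ((pair (fst P A) F).comp G) ≅
        (pair (LCFunctor.id P) (b.dagger ((pair (fst P B) G).comp F))).comp G)) ∧
    -- double dagger identity
    (∀ (A : Type u₁) [Category.{v₁} A] [OCategory A]
      (B : Type u₂) [Category.{v₂} B] [OCategory B] [SupportsCanonicalFixedPoints B]
      (b : FixChoice B) (F : A × (B × B) ⥤ₒ B),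
      Nonempty (b.dagger (b.dagger ((assoc A B B).comp F)) ≅
        b.dagger ((prodMap (LCFunctor.id A)
          (pair (LCFunctor.id B) (LCFunctor.id B))).comp F))) ∧
    -- abstraction identity
    (∀ (A : Type u₁) [Category.{v₁} A] [OCategory A] (B : Type u₂) [Category.{v₂} B] [OCategory B]
      (C : Type u₃) [Category.{v₃} C] [OCategory C] [SupportsCanonicalFixedPoints C]
      (c : FixChoice C) (e : FixChoice (B ⥤ₒ C)),
      Nonempty
        (precomp C (assoc A B C) ⋙ c.daggerFunctor (A × B) ⋙ curryFunctor A B C ≅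
          precomp C (prodMap (LCFunctor.id A) (pair (snd (B ⥤ₒ C) B) (ev B C))) ⋙
            precomp C (assoc A (B ⥤ₒ C) B) ⋙ curryFunctor (A × (B ⥤ₒ C)) B C ⋙
              e.daggerFunctor A)) ∧
    -- power identities
    (∀ (A : Type u₁) [Category.{v₁} A] [OCategory A]
      (B : Type u₂) [Category.{v₂} B] [OCategory B] [SupportsCanonicalFixedPoints B]
      (b : FixChoice B) (F : A × B ⥤ₒ B) (n : ℕ), 1 < n →
      Nonempty (b.dagger (F.power n) ≅ b.dagger F)) := by
  refine ⟨?_, ?_, ?_, ?_, ?_⟩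
  · intro A _ _ B _ _ C _ _ _ c F G
    exact ⟨(c.daggerAlgebra _).iso ((c.daggerAlgebra F).reindex G)⟩
  · intro P _ _ A _ _ _ B _ _ _ a b F G
    exact ⟨(a.daggerAlgebra _).iso (b.daggerAlgebra _).roll⟩
  · intro A _ _ B _ _ _ b F
    exact ⟨((b.daggerAlgebra _).diag (b.daggerAlgebra _)).iso (b.daggerAlgebra _)⟩
  · intro A _ _ B _ _ C _ _ _ c e
    exact ⟨abstractionIso A B C c e⟩
  · intro A _ _ B _ _ _ b F n hn
    -- Writing the exponent as a successor excludes `F⁰ = π₂`, whose initial algebra is just the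
    -- initial object.
    obtain ⟨n, rfl⟩ := Nat.exists_eq_succ_of_ne_zero (Nat.ne_zero_of_lt hn)
    exact ⟨(b.daggerAlgebra _).iso ((b.daggerAlgebra F).power n (b.daggerAlgebra _))⟩
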